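/- **Setting.** Two players have independent private types with a common absolutely continuous law $F$ with support $\Theta=(\underline\theta,\overline\theta)$, $0\le\underline\theta<\overline\theta\le\infty$, whose density $f$ is continuous and strictly positive on $\Theta$. They choose stopping times in $[0,\infty]$. In the *original game* type $\theta$ stopping at $a$ against $b$ gets $\theta-b$ if $a>b$, $\theta/2-a$ if $a=b$, and $-a$ if $a<b$. In the *Amann–Leininger game* with parameter $\delta\in(0,1)$ the payoff for $a>b$ is replaced by $\theta-(\delta b+(1-\delta)a)$. In the *crazy-types game* with mass $\epsilon\in(0,1)$ each player is, independently of everything else, crazy with probability $\epsilon$ and then stops at $\infty$ (a crazy type gets $\theta,\theta/2,0$ for $a>b$, $a=b$, $a<b$), and otherwise has the payoffs of the original game. Equilibrium means Bayesian Nash equilibrium in pure strategies $(\sigma_1,\sigma_2)$ (of the normal types, in the crazy-types game), with players labelled so that no type of Player 2 stops at $0$. The type-to-type function of an equilibrium is $k=\sigma_2^{-1}\circ\sigma_1$ on the types of Player 1 stopping in $(0,\infty)$, extended to $\Theta$ by $\underline\theta$ where $\sigma_1=0$ and by $\overline\theta$ where $\sigma_1=\infty$. Let $\mathcal E$, $\mathcal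 E(\delta)$ and $\mathcal E^{BT}(\epsilon)$ be the sets of real-valued type-to-type functions on $\Theta$ of equilibria of the three games. With the topology of uniform convergence on compact subsets of $\Theta$, put $\mathcal{AL}=\limsup_{\delta\to1^-}\mathcal E(\delta)$ and $\mathcal{BT}=\limsup_{\epsilon\to0^+}\mathcal E^{BT}(\epsilon)$, where $\limsup$ is the outer limit (the set of all cluster points). For $\theta^\circ\in\Theta$ let $$\Lambda_\delta(\theta)=\int_{\theta^\circ}^{\theta}\frac{f(x)}{x\,(1-\delta F(x))}\,dx .$$ **Proposition 1 (Refinement Equivalence).** (i) Let $\epsilon\in(0,1)$ and $\delta=1-\epsilon$. Every equilibrium of the crazy-types game with mass $\epsilon$ has exactly one type-to-type function $k$, and at every type $\theta$ of Player 1 stopping in $(0,\infty)$ it satisfies $$k'(\theta)=\frac{1-(1-\epsilon)F(k(\theta))}{1-(1-\epsilon)F(\theta)}\cdot\frac{k(\theta)\,f(\theta)}{\theta\,f(k(\theta))}.$$ Every equilibrium of the Amann–Leininger game with parameter $\delta$ likewise has exactly one type-to-type function, which satisfies the same equation with $1-\epsilon$ replaced by $\delta$. In both games the associated perturbed hazard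 potential is $\Lambda_\delta$: it is strictly increasing on $\Theta$, and $\Lambda_\delta(\theta)-\Lambda_\delta(k(\theta))$ is constant over the types $\theta$ of Player 1 stopping in $(0,\infty)$. (ii) For every $\delta\in(0,1)$, $\mathcal E(\delta)=\mathcal E^{BT}(1-\delta)$, and there is a bijection from the equilibria of the Amann–Leininger game with parameter $\delta$ onto those of the crazy-types game with mass $1-\delta$ that preserves the type-to-type function. (iii) $\mathcal{AL}=\mathcal{BT}$, as subsets of the equilibrium set $\mathcal E$ of the original game. -/

import Mathlib

open MeasureTheory Set Filter Topology
open scoped ENNReal UniformConvergence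

noncomputable section

namespace WarOfAttrition

/-- A type distribution: an absolutely continuous law with support the interval `(lo, hi)`,
`0 ≤ lo < hi ≤ ∞`, whose density `f` is continuous and strictly positive there.
Only the values of `f` on the interval matter. -/
structure TypeLaw where
  lo : ℝ
  hi : EReal
  f : ℝ → ℝ
  lo_nonneg : 0 ≤ lo
  lo_lt_hi : (lo : EReal) < hi
  f_cont : ContinuousOn f {x : ℝ | lo < x ∧ (x : EReal) < hi}
  f_pos : ∀ x : ℝ, lo < x → (x : EReal) < hi → 0 < f x
  f_mass : ∫⁻ x in {x : ℝ | lo < x ∧ (x : EReal) < hi}, ENNReal.ofReal (f x) = 1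

/-- The type space, the open interval `(lo, hi)`. -/
def TypeLaw.Θ (D : TypeLaw) : Set ℝ := {x : ℝ | D.lo < x ∧ (x : EReal) < D.hi}

/-- The law of a type, as a measure on the type space. -/
def TypeLaw.μ (D : TypeLaw) : Measure D.Θ :=
  ((volume : Measure ℝ).comap (Subtype.val : D.Θ → ℝ)).withDensity fun θ => ENNReal.ofReal (D.f θ)

/-- The distribution function of the types. -/
def TypeLaw.F (D : TypeLaw) (x : ℝ) : ℝ := (D.μ {t : D.Θ | (t : ℝ) ≤ x}).toReal

/-! ### Payoffs

Stopping times are elements of `[0, ∞]`; `a` is the player's own stopping time, `b` the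
opponent's, `θ` the player's valuation. Payoffs are extended reals, since stopping at `∞` may cost
an infinite amount. -/

/-- Payoff of the original war of attrition. -/
def basePayoff (θ : ℝ) (a b : ℝ≥0∞) : EReal :=
  if b < a then (θ : EReal) - (b : EReal)
  else if a = b then ((θ / 2 : ℝ) : EReal) - (a : EReal)
  else -(a : EReal)

/-- Amann--Leininger payoff: the winner pays `δ b + (1 - δ) a`. -/
def alPayoff (δ θ : ℝ) (a b : ℝ≥0∞) : EReal :=
  if b < a then
    (θ : EReal) - ((ENNReal.ofReal δ * b + ENNReal.ofReal (1 - δ) * a : ℝ≥0∞) : EReal)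
  else if a = b then ((θ / 2 : ℝ) : EReal) - (a : EReal)
  else -(a : EReal)

/-- Payoff of a crazy type, who faces no costs. -/
def crazyPayoff (θ : ℝ) (a b : ℝ≥0∞) : EReal :=
  if b < a then (θ : EReal)
  else if a = b then ((θ / 2 : ℝ) : EReal)
  else 0

/-! ### Bayesian Nash equilibrium -/

/-- Expectation of an extended-real random variable, as the expectation of its positive part minus
that of its negative part. (All payoffs in this file are bounded above by the player's type, so
that the first term is finite.) -/
def expect {T : Type*} [MeasurableSpace T] (m : Measure T) (X : T → EReal) : EReal :=
  ((∫⁻ t, (X t).toENNReal ∂m : ℝ≥0∞) : EReal) - ((∫⁻ t, (-X t).toENNReal ∂m : ℝ≥0∞) : EReal)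

/-- Every type `t` finds `s t` optimal among all stopping times in `[0, ∞]` against the opponent's
strategy `s'`, when the opponent's type has law `m` and type `t` has payoff `u t a b`. -/
def IsBestResponse {T : Type*} [MeasurableSpace T] (m : Measure T)
    (u : T → ℝ≥0∞ → ℝ≥0∞ → EReal) (s s' : T → ℝ≥0∞) : Prop :=
  ∀ (t : T) (a : ℝ≥0∞),
    expect m (fun t' => u t a (s' t')) ≤ expect m (fun t' => u t (s t) (s' t'))

/-- Bayesian Nash equilibrium of the symmetric two-player stopping game with independent types of
law `m` and payoffs `u`. -/
def IsBNE {T : Type*} [MeasurableSpace T] (m : Measure T)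
    (u : T → ℝ≥0∞ → ℝ≥0∞ → EReal) (s₁ s₂ : T → ℝ≥0∞) : Prop :=
  Measurable s₁ ∧ Measurable s₂ ∧ IsBestResponse m u s₁ s₂ ∧ IsBestResponse m u s₂ s₁

namespace TypeLaw

variable (D : TypeLaw)

/-- Pairs of strategies, each a stopping time in `[0, ∞]` for every type. -/
abbrev Profile : Type := (D.Θ → ℝ≥0∞) × (D.Θ → ℝ≥0∞)

/-! ### The three games

In each of them players are labelled so that only Player 1 may concede immediately with positive
probability, i.e. no type of Player 2 stops at `0`. -/

/-- Equilibria of the original game. -/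
def baseEquilibria : Set D.Profile :=
  {p | IsBNE D.μ (fun θ : D.Θ => basePayoff θ) p.1 p.2 ∧ ∀ θ, p.2 θ ≠ 0}

/-- Equilibria of the Amann--Leininger game with parameter `δ`. -/
def alEquilibria (δ : ℝ) : Set D.Profile :=
  {p | IsBNE D.μ (fun θ : D.Θ => alPayoff δ θ) p.1 p.2 ∧ ∀ θ, p.2 θ ≠ 0}

/-- The law of a type in the game with crazy types of mass `ε`; the second coordinate, independent
of the valuation, is `true` for crazy and `false` for normal types. -/
def btLaw (ε : ℝ) : Measure (D.Θ × Bool) :=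
  D.μ.prod (ENNReal.ofReal (1 - ε) • Measure.dirac false + ENNReal.ofReal ε • Measure.dirac true)

/-- Payoffs in the game with crazy types. -/
def btPayoff (t : D.Θ × Bool) (a b : ℝ≥0∞) : EReal :=
  if t.2 = true then crazyPayoff t.1 a b else basePayoff t.1 a b

/-- The strategy on the enlarged type space in which normal types use `σ` and crazy types fight
forever. -/
def withCrazy {D : TypeLaw} (σ : D.Θ → ℝ≥0∞) (t : D.Θ × Bool) : ℝ≥0∞ :=
  if t.2 = true then ∞ else σ t.1

/-- Equilibria of the game with crazy types of mass `ε`, restricted to the normal types. -/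
def btEquilibria (ε : ℝ) : Set D.Profile :=
  {p | IsBNE (D.btLaw ε) D.btPayoff (withCrazy p.1) (withCrazy p.2) ∧ ∀ θ, p.2 θ ≠ 0}

/-! ### Type-to-type functions -/

/-- `k` is the type-to-type function `σ₂⁻¹ ∘ σ₁` of the profile: a type of Player 1 who stops at a
time in `(0, ∞)` is mapped to a type of Player 2 who stops at the same time. It is extended to
the whole type space by its boundary values: `lo` for the types of Player 1 who concede
immediately, `hi` for those who fight forever. -/
def IsTypeToType (p : D.Profile) (k : D.Θ → ℝ) : Prop :=
  ∀ θ : D.Θ,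
    (p.1 θ = 0 → k θ = D.lo) ∧
    (p.1 θ ≠ 0 → p.1 θ ≠ ∞ → ∃ t : D.Θ, (t : ℝ) = k θ ∧ p.2 t = p.1 θ) ∧
    (p.1 θ = ∞ → (k θ : EReal) = D.hi)

/-- Real functions on the type space, with uniform convergence on compact subsets. -/
abbrev MapSpace : Type := D.Θ →ᵤ[{K : Set D.Θ | IsCompact K}] ℝ

/-- The type-to-type functions of a set of profiles. -/
def typeToTypeMaps (P : Set D.Profile) : Set D.MapSpace :=
  {k | ∃ p ∈ P, D.IsTypeToType p (UniformOnFun.toFun _ k)}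

/-- Equilibrium type-to-type functions of the original game. -/
def baseE : Set D.MapSpace := D.typeToTypeMaps D.baseEquilibria

/-- Equilibrium type-to-type functions of the Amann--Leininger game. -/
def alE (δ : ℝ) : Set D.MapSpace := D.typeToTypeMaps (D.alEquilibria δ)

/-- Equilibrium type-to-type functions of the game with crazy types. -/
def btE (ε : ℝ) : Set D.MapSpace := D.typeToTypeMaps (D.btEquilibria ε)

/-! ### The perturbed differential equation and hazard potential -/

/-- The right-hand side of the perturbed equation at the type `θ` when the type-to-type function
takes the value `y` there. -/
def odeRHS (δ θ y : ℝ) : ℝ :=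
  (1 - δ * D.F y) / (1 - δ * D.F θ) * (y * D.f θ / (θ * D.f y))

/-- `k` solves the perturbed equation at all types of Player 1 who stop at a time in `(0, ∞)`. The
value chosen off the open type interval does not affect the derivative. -/
def SolvesODE (δ : ℝ) (p : D.Profile) (k : D.Θ → ℝ) : Prop :=
  ∀ θ : D.Θ, p.1 θ ≠ 0 → p.1 θ ≠ ∞ →
    HasDerivAt (Function.extend Subtype.val k fun _ => 0) (D.odeRHS δ θ (k θ)) θ

/-- The perturbed hazard potential with reference point `θ₀`. -/
def hazardPotential (δ θ₀ θ : ℝ) : ℝ :=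
  ∫ x in θ₀..θ, D.f x / (x * (1 - δ * D.F x))

/-- The integral identity: `Λ_δ(θ) - Λ_δ(k(θ))` is constant over the types of Player 1 who stop at
a time in `(0, ∞)`. -/
def HasPotential (δ : ℝ) (p : D.Profile) (k : D.Θ → ℝ) : Prop :=
  ∀ θ₀ : D.Θ, ∃ C : ℝ, ∀ θ : D.Θ, p.1 θ ≠ 0 → p.1 θ ≠ ∞ →
    D.hazardPotential δ θ₀ θ - D.hazardPotential δ θ₀ (k θ) = C

end TypeLaw

/-! ### Outer limits and selections -/

/-- The outer limit (topological limit superior) of a family of sets along a filter. -/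
def outerLimit {ι X : Type*} [TopologicalSpace X] (l : Filter ι) (E : ι → Set X) : Set X :=
  ⋂ s ∈ l, closure (⋃ i ∈ s, E i)

/-- The Amann--Leininger selection, the outer limit as `δ → 1⁻`. -/
def TypeLaw.AL (D : TypeLaw) : Set D.MapSpace := outerLimit (𝓝[<] (1 : ℝ)) D.alE

/-- The behavioral-types selection, the outer limit as `ε → 0⁺`. -/
def TypeLaw.BT (D : TypeLaw) : Set D.MapSpace := outerLimit (𝓝[>] (0 : ℝ)) D.btE

end WarOfAttrition

end

noncomputable section

namespace WarOfAttrition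

namespace TypeLaw

variable (D : TypeLaw)

/-! ### The type space and its law -/

/-! Two facts carry the theorem. The first is a change of units (`expect_btPayoff`). Take `ε = 1 -
δ` and multiply all stopping times by `δ`. A normal type then meets a normal opponent with
probability `δ` and pays `δ min(a, b)`, and meets a crazy one with probability `1 - δ`, loses, and
pays `δ a`. The expected payoff is `δ` times the Amann–Leininger payoff, and crazy types are always
content to fight forever. So `rescale` is a bijection of equilibria (`bijOn_rescale`), and it
preserves type-to-type functions because these only compare stopping times with each other, with `0`
and with `∞`.

The second is that equilibria of the perturbed games are symmetric (`IsRealEq.eq`). Let `G`, `G'` be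
the distribution functions of the two players' stopping times, and let `θ`, `θ'` be the types
stopping at a given time. After atoms and gaps at positive times are excluded, the first-order
conditions read `(log (1 - δ G'))' = -δ / θ` and `(log (1 - δ G))' = -δ / θ'`. The difference `L` of
these logarithms, that of `G` minus that of `G'`, has derivative `δ (1/θ - 1/θ')`, whose sign agrees
with that of `L`, since `θ ≤ θ'` means `G ≤ G'`. Hence `L ^ 2` is nondecreasing. Both distribution
functions tend to `1` and `log (1 - δ)` is finite because `δ < 1`, so `L` tends to `0` and must
vanish throughout.

The only perturbed type-to-type function is therefore the inclusion of the type space, for which the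
differential equation and the potential identity are immediate. For (iii), both outer limits lie in
the closed singleton of the inclusion, and that map belongs to the original game because `θ ↦ ∫ x
f(x) / (1 - F(x)) dx`, integrated up to `θ`, is a symmetric equilibrium strategy there. Existence of
perturbed equilibria is never needed. -/

lemma isOpen_Θ : IsOpen D.Θ :=
  (isOpen_lt continuous_const continuous_id).inter
    (isOpen_lt continuous_coe_real_ereal continuous_const)

lemma measurableSet_Θ : MeasurableSet D.Θ := D.isOpen_Θ.measurableSet

instance ordConnected_Θ : OrdConnected D.Θ :=
  ⟨fun _ hx _ hy _ hz =>
    ⟨hx.1.trans_le hz.1, (EReal.coe_le_coe_iff.2 hz.2).trans_lt hy.2⟩⟩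

lemma pos (θ : D.Θ) : 0 < (θ : ℝ) := D.lo_nonneg.trans_lt θ.2.1

lemma exists_gt_of_pos (θ : D.Θ) {r : ℝ} (hr : 0 < r) : ∃ t : D.Θ, θ < t ∧ (t : ℝ) < θ + r := by
  have h : ∀ᶠ x in 𝓝[>] (θ : ℝ), x ∈ D.Θ ∧ x ∈ Ioo (θ : ℝ) (θ + r) :=
    Filter.inter_mem (mem_nhdsWithin_of_mem_nhds (D.isOpen_Θ.mem_nhds θ.2))
      (Ioo_mem_nhdsGT (by linarith))
  obtain ⟨x, hx, hx'⟩ := h.exists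
  exact ⟨⟨x, hx⟩, hx'.1, hx'.2⟩

lemma exists_lt_of_pos (θ : D.Θ) {r : ℝ} (hr : 0 < r) : ∃ t : D.Θ, t < θ ∧ (θ : ℝ) - r < t := by
  have h : ∀ᶠ x in 𝓝[<] (θ : ℝ), x ∈ D.Θ ∧ x ∈ Ioo ((θ : ℝ) - r) θ :=
    Filter.inter_mem (mem_nhdsWithin_of_mem_nhds (D.isOpen_Θ.mem_nhds θ.2))
      (Ioo_mem_nhdsLT (by linarith))
  obtain ⟨x, hx, hx'⟩ := h.exists
  exact ⟨⟨x, hx⟩, hx'.2, hx'.1⟩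

lemma continuous_f : Continuous fun θ : D.Θ => D.f θ :=
  continuousOn_iff_continuous_domRestrict.1 D.f_cont

lemma measurable_density : Measurable fun θ : D.Θ => ENNReal.ofReal (D.f θ) :=
  D.continuous_f.measurable.ennreal_ofReal

instance isProbabilityMeasure_μ : IsProbabilityMeasure D.μ := by
  refine ⟨?_⟩
  rw [TypeLaw.μ, withDensity_apply _ MeasurableSet.univ, Measure.restrict_univ,
    lintegral_subtype_comap D.measurableSet_Θ fun x => ENNReal.ofReal (D.f x)]
  exact D.f_mass

lemma comap_apply (s : Set D.Θ) :
    ((volume : Measure ℝ).comap (Subtype.val : D.Θ → ℝ)) s = volume (Subtype.val '' s) :=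
  comap_subtype_coe_apply D.measurableSet_Θ _ _

instance nullSingletonClass_μ : NullSingletonClass D.μ := by
  refine ⟨fun x => ?_⟩
  refine withDensity_absolutelyContinuous _ _ ?_
  rw [comap_apply, image_singleton]
  exact measure_singleton _

lemma μ_Ioo_pos {x y : D.Θ} (h : x < y) : 0 < D.μ (Ioo x y) := by
  rw [pos_iff_ne_zero, TypeLaw.μ, Ne, withDensity_apply_eq_zero D.measurable_density, comap_apply]
  have hsub : Ioo (x : ℝ) y ⊆
      Subtype.val '' ({t : D.Θ | ENNReal.ofReal (D.f t) ≠ 0} ∩ Ioo x y) := by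
    intro z hz
    have hz' : z ∈ D.Θ := D.ordConnected_Θ.out x.2 y.2 (Ioo_subset_Icc_self hz)
    refine ⟨⟨z, hz'⟩, ⟨?_, hz.1, hz.2⟩, rfl⟩
    simpa using D.f_pos z hz'.1 hz'.2
  intro h0
  have := measure_mono_null hsub h0
  rw [Real.volume_Ioo, ENNReal.ofReal_eq_zero] at this
  have : (x : ℝ) < y := h
  linarith

/-- The distribution function, on the type space. -/
def cdfΘ (θ : D.Θ) : ℝ := D.μ.real (Iic θ)

lemma cdfΘ_eq_Iio (θ : D.Θ) : D.cdfΘ θ = D.μ.real (Iio θ) :=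
  (measureReal_congr Iio_ae_eq_Iic).symm

lemma cdfΘ_strictMono : StrictMono D.cdfΘ := by
  intro x y h
  have h1 : D.μ.real (Iic x ∪ Ioo x y) = D.μ.real (Iic x) + D.μ.real (Ioo x y) :=
    measureReal_union (Set.disjoint_left.2 fun z hz hz' => absurd hz'.1 (not_lt.2 hz))
      measurableSet_Ioo
  have h2 : 0 < D.μ.real (Ioo x y) := ENNReal.toReal_pos (D.μ_Ioo_pos h).ne' (measure_ne_top _ _)
  have h3 : D.μ.real (Iic x ∪ Ioo x y) ≤ D.μ.real (Iic y) :=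
    measureReal_mono (union_subset (Iic_subset_Iic.2 h.le) fun z hz => hz.2.le)
  simp only [cdfΘ]
  linarith

lemma cdfΘ_lt_one (θ : D.Θ) : D.cdfΘ θ < 1 := by
  obtain ⟨t, ht, -⟩ := D.exists_gt_of_pos θ one_pos
  exact (D.cdfΘ_strictMono ht).trans_le measureReal_le_one

instance : Nonempty D.Θ := nonempty_of_isProbabilityMeasure D.μ

instance : NoMaxOrder D.Θ := ⟨fun θ => (D.exists_gt_of_pos θ one_pos).imp fun _ h => h.1⟩

instance : NoMinOrder D.Θ := ⟨fun θ => (D.exists_lt_of_pos θ one_pos).imp fun _ h => h.1⟩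

/-- Using `atTop` of the ordered type space, rather than a limit at `hi`, treats finite and infinite
`hi` alike. -/
lemma tendsto_cdfΘ_atTop : Tendsto D.cdfΘ atTop (𝓝 1) := by
  have h := tendsto_measure_iUnion_atTop (μ := D.μ) (s := fun θ : D.Θ => Iic θ)
    fun _ _ h => Iic_subset_Iic.2 h
  rw [iUnion_Iic, measure_univ] at h
  exact (ENNReal.tendsto_toReal ENNReal.one_ne_top).comp h

end TypeLaw

namespace TypeLaw

variable {D : TypeLaw}

/-! ### The Amann--Leininger game with real stopping times -/

/-- Probability of winning at the time `a` against `s`, ties counting one half. -/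
def winProb (s : D.Θ → ℝ) (a : ℝ) : ℝ := D.μ.real {t | s t < a} + D.μ.real {t | s t = a} / 2

/-- Expected Amann--Leininger cost of stopping at `a` against `s`. -/
def expCost (δ : ℝ) (s : D.Θ → ℝ) (a : ℝ) : ℝ := ∫ t, (δ * min a (s t) + (1 - δ) * a) ∂D.μ

/-- Mutual best responses in the Amann--Leininger game, with finite stopping times. -/
structure IsRealEq (δ : ℝ) (s s' : D.Θ → ℝ) : Prop where
  δ_pos : 0 < δ
  δ_lt : δ < 1
  meas : Measurable s
  meas' : Measurable s'
  nonneg : ∀ t, 0 ≤ s t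
  nonneg' : ∀ t, 0 ≤ s' t
  best : ∀ (θ : D.Θ) (a : ℝ), 0 ≤ a →
    θ * winProb s' a - expCost δ s' a ≤ θ * winProb s' (s θ) - expCost δ s' (s θ)
  best' : ∀ (θ : D.Θ) (a : ℝ), 0 ≤ a →
    θ * winProb s a - expCost δ s a ≤ θ * winProb s (s' θ) - expCost δ s (s' θ)

lemma winProb_nonneg (s : D.Θ → ℝ) (a : ℝ) : 0 ≤ winProb s a := by
  unfold winProb; positivity

lemma winProb_le (s : D.Θ → ℝ) (hs : Measurable s) (a : ℝ) :
    winProb s a ≤ D.μ.real {t | s t ≤ a} := by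
  have h : D.μ.real ({t | s t < a} ∪ {t | s t = a}) =
      D.μ.real {t | s t < a} + D.μ.real {t | s t = a} :=
    measureReal_union (Set.disjoint_left.2 fun t h h' => (ne_of_lt h) h')
      (hs (measurableSet_singleton a))
  have h' : {t | s t < a} ∪ {t | s t = a} = {t | s t ≤ a} := by
    ext t; simp [le_iff_lt_or_eq]
  have : 0 ≤ D.μ.real {t | s t = a} := measureReal_nonneg
  rw [h'] at h
  unfold winProb
  linarith

lemma le_winProb (s : D.Θ → ℝ) (a : ℝ) : D.μ.real {t | s t < a} ≤ winProb s a := by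
  have : 0 ≤ D.μ.real {t | s t = a} := measureReal_nonneg
  unfold winProb
  linarith

lemma integrable_expCost (δ : ℝ) {s : D.Θ → ℝ} (hs : Measurable s) (hs0 : ∀ t, 0 ≤ s t) {a : ℝ}
    (ha : 0 ≤ a) : Integrable (fun t => δ * min a (s t) + (1 - δ) * a) D.μ := by
  refine Integrable.add (Integrable.const_mul ?_ δ) (integrable_const _)
  refine Integrable.of_bound (measurable_const.min hs).aestronglyMeasurable a ?_
  filter_upwards with t
  rw [Real.norm_of_nonneg (le_min ha (hs0 t))]
  exact min_le_left _ _

/-- The marginal cost at time `c` is `1 - δ P(s < c)`, which decreases in `c`; its values at the two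
ends bound the increment. Both bounds come from integrating pointwise inequalities. -/
lemma expCost_sub_bounds {δ : ℝ} (hδ : 0 < δ) {s : D.Θ → ℝ} (hs : Measurable s)
    (hs0 : ∀ t, 0 ≤ s t) {a b : ℝ} (ha : 0 ≤ a) (hab : a ≤ b) :
    (b - a) * (1 - δ * D.μ.real {t | s t < b}) ≤ expCost δ s b - expCost δ s a ∧
      expCost δ s b - expCost δ s a ≤ (b - a) * (1 - δ * D.μ.real {t | s t < a}) := by
  have hb : 0 ≤ b := ha.trans hab
  have key : expCost δ s b - expCost δ s a =
      ∫ t, ((δ * min b (s t) + (1 - δ) * b) - (δ * min a (s t) + (1 - δ) * a)) ∂D.μ :=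
    (integral_sub (integrable_expCost δ hs hs0 hb) (integrable_expCost δ hs hs0 ha)).symm
  have hind : ∀ c : ℝ, ∫ t, ((b - a) - (b - a) * δ * ({t | s t < c}.indicator 1 t)) ∂D.μ =
      (b - a) * (1 - δ * D.μ.real {t | s t < c}) := by
    intro c
    have hm : MeasurableSet {t | s t < c} := measurableSet_lt hs measurable_const
    have hi : Integrable ({t | s t < c}.indicator (1 : D.Θ → ℝ)) D.μ :=
      (integrable_const (1 : ℝ)).indicator hm
    rw [integral_sub (integrable_const _) (hi.const_mul _), integral_const, integral_const_mul,
      integral_indicator_one hm]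
    simp
    ring
  have hii : ∀ c : ℝ, Integrable
      (fun t => (b - a) - (b - a) * δ * ({t | s t < c}.indicator 1 t)) D.μ := by
    intro c
    exact (integrable_const _).sub
      (((integrable_const (1 : ℝ)).indicator (measurableSet_lt hs measurable_const)).const_mul _)
  have hd := (integrable_expCost δ hs hs0 hb).sub (integrable_expCost δ hs hs0 ha)
  rw [key, ← hind a, ← hind b]
  refine ⟨integral_mono (hii b) hd fun t => ?_, integral_mono hd (hii a) fun t => ?_⟩
  · have h1 : min a (s t) ≤ a := min_le_left _ _
    have h2 : min a (s t) ≤ min b (s t) := min_le_min_right _ hab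
    by_cases h : s t < b
    · simp only [indicator, mem_ofPred_eq, h, if_true, Pi.one_apply]
      nlinarith
    · simp only [indicator, mem_ofPred_eq, h, if_false, min_eq_left (not_lt.1 h)]
      nlinarith
  · by_cases h : s t < a
    · simp only [indicator, mem_ofPred_eq, h, if_true, Pi.one_apply, min_eq_right h.le,
        min_eq_right (h.le.trans hab)]
      nlinarith
    · simp only [indicator, mem_ofPred_eq, h, if_false, min_eq_left (not_lt.1 h)]
      have h1 : min b (s t) ≤ b := min_le_left _ _
      nlinarith

/-! ### Structure of equilibrium strategies: monotonicity, no atoms, no gaps. -/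

namespace IsRealEq

variable {δ : ℝ} {s s' : D.Θ → ℝ}

lemma symm (E : IsRealEq δ s s') : IsRealEq δ s' s :=
  ⟨E.δ_pos, E.δ_lt, E.meas', E.meas, E.nonneg', E.nonneg, E.best', E.best⟩

/-- Even a player who wins pays the share `1 - δ` of the own time, so waiting is strictly costly. -/
lemma le_cost (E : IsRealEq δ s s') {a b : ℝ} (ha : 0 ≤ a) (hab : a ≤ b) :
    (1 - δ) * (b - a) ≤ expCost δ s b - expCost δ s a := by
  have h := (expCost_sub_bounds E.δ_pos E.meas E.nonneg ha hab).1
  have h1 : D.μ.real {t | s t < b} ≤ 1 := measureReal_le_one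
  have := mul_nonneg (mul_nonneg E.δ_pos.le (sub_nonneg.2 h1)) (sub_nonneg.2 hab)
  nlinarith

lemma cost_le (E : IsRealEq δ s s') {a b : ℝ} (ha : 0 ≤ a) (hab : a ≤ b) :
    expCost δ s b - expCost δ s a ≤ b - a := by
  have h := (expCost_sub_bounds E.δ_pos E.meas E.nonneg ha hab).2
  have h1 : 0 ≤ D.μ.real {t | s t < a} := measureReal_nonneg
  have := mul_nonneg (mul_nonneg E.δ_pos.le h1) (sub_nonneg.2 hab)
  nlinarith

/-- A type never stops at `a` if an earlier time wins as often. -/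
lemma winProb_lt (E : IsRealEq δ s s') (θ : D.Θ) {a : ℝ} (ha : 0 ≤ a) (h : a < s θ) :
    winProb s' a < winProb s' (s θ) := by
  have h1 := E.best θ a ha
  have h2 := E.symm.le_cost ha h.le
  have h3 := mul_pos (sub_pos.2 E.δ_lt) (sub_pos.2 h)
  have : 0 < (θ : ℝ) * (winProb s' (s θ) - winProb s' a) := by linarith
  exact sub_pos.1 (pos_of_mul_pos_right this (D.pos θ).le)

/-- Single crossing: adding the two optimality conditions contradicts the strict gain in winning
probability. -/
lemma monotone (E : IsRealEq δ s s') : Monotone s := by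
  intro x y hxy
  rcases hxy.eq_or_lt with rfl | hlt
  · exact le_rfl
  by_contra! h
  have h1 := E.best x (s y) (E.nonneg y)
  have h2 := E.best y (s x) (E.nonneg x)
  have h3 := E.winProb_lt x (E.nonneg y) h
  have h4 : (x : ℝ) < y := hlt
  nlinarith

/-- The equilibrium strategies have no atoms except possibly at `0`. -/
lemma no_atom (E : IsRealEq δ s s') {a : ℝ} (ha : 0 < a) : D.μ.real {t | s' t = a} = 0 := by
  by_contra hne
  have hp : 0 < D.μ.real {t | s' t = a} := lt_of_le_of_ne measureReal_nonneg (Ne.symm hne)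
  set p := D.μ.real {t | s' t = a} with hpdef
  -- Jumping just past the atom gains at least `p / 2` in winning probability at a cost of at most
  -- the extra time.
  have hdev : ∀ θ : D.Θ, s θ ≤ a → s θ ≤ a - θ * p / 2 := by
    intro θ hθ
    refine le_of_forall_pos_le_add fun η hη => ?_
    have h1 := E.best θ (a + η) (by linarith)
    have h2 := E.symm.cost_le (E.nonneg θ) (show s θ ≤ a + η by linarith)
    have h3 : winProb s' (s θ) + p / 2 ≤ winProb s' (a + η) := by
      have h4 : winProb s' (s θ) ≤ winProb s' a := by
        rcases hθ.eq_or_lt with h | h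
        · rw [h]
        · exact (winProb_le s' E.meas' _).trans ((measureReal_mono
            fun t (ht : s' t ≤ s θ) => ht.trans_lt h).trans (le_winProb s' a))
      have h5 : D.μ.real ({t | s' t < a} ∪ {t | s' t = a}) = D.μ.real {t | s' t < a} + p :=
        measureReal_union (Set.disjoint_left.2 fun t h h' => (ne_of_lt h) h')
          (E.meas' (measurableSet_singleton a))
      have h6 : D.μ.real ({t | s' t < a} ∪ {t | s' t = a}) ≤ D.μ.real {t | s' t < a + η} := by
        refine measureReal_mono ?_
        rintro t (ht | ht) <;> simp only [mem_ofPred_eq] at ht ⊢ <;> linarith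
      have h7 := le_winProb s' (a + η)
      have h8 : winProb s' a = D.μ.real {t | s' t < a} + p / 2 := rfl
      linarith
    have h4 := mul_le_mul_of_nonneg_left h3 (D.pos θ).le
    linarith
  obtain ⟨t, ht⟩ : ∃ t, s' t = a := by
    by_contra! h
    refine hne ?_
    rw [hpdef, show {t | s' t = a} = ∅ from eq_empty_iff_forall_notMem.2 h, measureReal_empty]
  -- Otherwise `hdev` leaves nobody stopping by `a`, and the type `t` would do better at `0`.
  obtain ⟨θ₀, hθ₀⟩ : ∃ θ₀, s θ₀ < a := by
    by_contra! h
    have h1 := E.symm.winProb_lt t le_rfl (ht ▸ ha)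
    have h2 : {θ | s θ ≤ a} = ∅ := by
      refine eq_empty_iff_forall_notMem.2 fun θ hθ => ?_
      have := hdev θ hθ
      have := h θ
      have := mul_pos (D.pos θ) hp
      linarith
    have h3 := winProb_le s E.meas a
    rw [h2, measureReal_empty, ← ht] at h3
    linarith [winProb_nonneg s 0]
  -- A bound uniform in the type: monotonicity handles types below `θ₀`, `hdev` those above. The
  -- interval `(a₁, a]` is then free of opponents, so `t` should stop earlier than `a`.
  set a₁ := max (s θ₀) (a - θ₀ * p / 2) with ha₁
  have hlt : a₁ < a := max_lt hθ₀ (by have := mul_pos (D.pos θ₀) hp; linarith)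
  have hnn : 0 ≤ a₁ := (E.nonneg θ₀).trans (le_max_left _ _)
  have hall : ∀ θ, s θ ≤ a → s θ ≤ a₁ := by
    intro θ hθ
    rcases le_total θ θ₀ with h | h
    · exact (E.monotone h).trans (le_max_left _ _)
    · refine (hdev θ hθ).trans (le_trans ?_ (le_max_right _ _))
      have h' : (θ₀ : ℝ) ≤ θ := h
      nlinarith
  have h1 := E.symm.winProb_lt t (a := (a₁ + a) / 2) (by linarith) (by linarith)
  rw [ht] at h1
  have h2 : winProb s a ≤ winProb s ((a₁ + a) / 2) :=
    (winProb_le s E.meas a).trans ((measureReal_mono fun θ (hθ : s θ ≤ a) => show s θ < _ by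
      have := hall θ hθ; linarith).trans (le_winProb s _))
  linarith

/-- The law of the stopping time of `s`, as a distribution function. -/
lemma winProb_eq (E : IsRealEq δ s s') {a : ℝ} (ha : 0 < a) :
    winProb s' a = D.μ.real {t | s' t < a} := by
  rw [winProb, E.no_atom ha]; simp

lemma real_le_eq (E : IsRealEq δ s s') {a : ℝ} (ha : 0 < a) :
    D.μ.real {t | s' t ≤ a} = D.μ.real {t | s' t < a} := by
  have h : D.μ.real ({t | s' t < a} ∪ {t | s' t = a}) =
      D.μ.real {t | s' t < a} + D.μ.real {t | s' t = a} :=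
    measureReal_union (Set.disjoint_left.2 fun t h h' => (ne_of_lt h) h')
      (E.meas' (measurableSet_singleton a))
  have h' : {t | s' t < a} ∪ {t | s' t = a} = {t | s' t ≤ a} := by
    ext t; simp [le_iff_lt_or_eq]
  rw [← h', h, E.no_atom ha, add_zero]

lemma real_lt_eq_cdf (E : IsRealEq δ s s') {θ : D.Θ} (h : 0 < s' θ) :
    D.μ.real {t | s' t < s' θ} = D.cdfΘ θ := by
  refine le_antisymm (measureReal_mono fun t ht => ?_) ?_
  · by_contra h1
    exact absurd ht (not_lt.2 (E.symm.monotone (le_of_lt (not_le.1 h1))))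
  · rw [← E.real_le_eq h]
    exact measureReal_mono fun t ht => E.symm.monotone ht

/-- A positive stopping time determines the quantile of its type, and the density is positive. -/
lemma inj (E : IsRealEq δ s s') {θ t : D.Θ} (h : 0 < s' θ) (hθ : s' θ = s' t) : θ = t := by
  refine D.cdfΘ_strictMono.injective ?_
  rw [← E.real_lt_eq_cdf h, ← E.real_lt_eq_cdf (hθ ▸ h), hθ]

lemma real_lt_mono (s : D.Θ → ℝ) {a b : ℝ} (h : a ≤ b) :
    D.μ.real {t | s t < a} ≤ D.μ.real {t | s t < b} :=
  measureReal_mono fun _ ht => lt_of_lt_of_le ht h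

lemma not_mem_of_flat (E : IsRealEq δ s s') {a b : ℝ} (ha : 0 < a)
    (hab : D.μ.real {t | s' t < a} = D.μ.real {t | s' t < b}) (θ : D.Θ) (h1 : a < s θ) :
    b < s θ := by
  by_contra! h2
  have := E.winProb_lt θ ha.le h1
  rw [E.winProb_eq ha, E.winProb_eq (ha.trans h1)] at this
  linarith [real_lt_mono s' h2]

/-- The distribution of stopping times is strictly increasing until it reaches `1`. -/
lemma eq_one_of_flat (E : IsRealEq δ s s') {a b : ℝ} (ha : 0 < a) (hab : a < b)
    (hflat : D.μ.real {t | s' t < a} = D.μ.real {t | s' t < b}) :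
    D.μ.real {t | s' t < a} = 1 := by
  by_contra hne
  have hlt1 : D.μ.real {t | s' t < b} < 1 := hflat ▸ lt_of_le_of_ne measureReal_le_one hne
  set S : Set ℝ := {c | b ≤ c ∧ ∃ t, s' t = c} with hS
  have hSne : S.Nonempty := by
    by_contra! h
    refine hlt1.ne ?_
    have : {t | s' t < b} = univ := by
      refine eq_univ_of_forall fun t => ?_
      by_contra h'
      exact eq_empty_iff_forall_notMem.1 h (s' t) ⟨not_lt.1 h', t, rfl⟩
    rw [this, probReal_univ]
  have hSbdd : BddBelow S := ⟨b, fun c hc => hc.1⟩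
  set B := sInf S with hB
  have hbB : b ≤ B := le_csInf hSne fun c hc => hc.1
  have hflatB : D.μ.real {t | s' t < a} = D.μ.real {t | s' t < B} := by
    refine le_antisymm (real_lt_mono _ (by linarith)) ?_
    rw [hflat]
    refine measureReal_mono fun t ht => ?_
    by_contra h'
    exact absurd (csInf_le hSbdd ⟨not_lt.1 h', t, rfl⟩) (not_le.2 ht)
  have hgap : ∀ θ, a < s θ → B < s θ := E.not_mem_of_flat ha hflatB
  obtain ⟨c₀, hc₀, t₀, ht₀⟩ := hSne
  have hmid : 0 < (a + b) / 2 := by linarith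
  obtain ⟨θ₀, hθ₀⟩ : ∃ θ₀, B < s θ₀ := by
    by_contra! h
    have h1 : ∀ θ, s θ ≤ a := fun θ => by
      by_contra! h'
      exact absurd (hgap θ h') (not_lt.2 (h θ))
    have h2 := E.symm.winProb_lt t₀ hmid.le (by rw [ht₀]; linarith)
    rw [E.symm.winProb_eq hmid, E.symm.winProb_eq (by rw [ht₀]; linarith)] at h2
    have h3 : {t | s t < (a + b) / 2} = univ :=
      eq_univ_of_forall fun t => show s t < _ by linarith [h1 t]
    rw [h3, probReal_univ] at h2
    exact absurd h2 (not_lt.2 measureReal_le_one)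
  have hBpos : 0 < B := by linarith
  -- By right continuity at `B`, the extra winning probability up to `c` is worth less to any type
  -- up to `θ₀` than the cost `(1 - δ) (b - a)` of crossing the gap.
  obtain ⟨c, hcB, hcθ, hc⟩ : ∃ c, B < c ∧ c ≤ s θ₀ ∧
      θ₀ * (D.μ.real {t | s' t < c} - D.μ.real {t | s' t < B}) < (1 - δ) * (b - a) := by
    have hprob : IsProbabilityMeasure (D.μ.map s') :=
      Measure.isProbabilityMeasure_map E.meas'.aemeasurable
    have hcont := ((ProbabilityTheory.cdf (D.μ.map s')).right_continuous B)
    have hval : ∀ x, ProbabilityTheory.cdf (D.μ.map s') x = D.μ.real {t | s' t ≤ x} := by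
      intro x
      rw [ProbabilityTheory.cdf_eq_real, map_measureReal_apply E.meas' measurableSet_Iic]
      rfl
    have hev : ∀ᶠ c in 𝓝[>] B, ProbabilityTheory.cdf (D.μ.map s') c <
        D.μ.real {t | s' t < B} + (1 - δ) * (b - a) / θ₀ := by
      refine (hcont.tendsto.mono_left
        (nhdsWithin_mono _ Ioi_subset_Ici_self)).eventually_lt_const ?_
      rw [hval, E.real_le_eq hBpos]
      have := div_pos (mul_pos (sub_pos.2 E.δ_lt) (sub_pos.2 hab)) (D.pos θ₀)
      linarith
    obtain ⟨c, hc1, hc2⟩ := (hev.and (Ioo_mem_nhdsGT hθ₀)).exists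
    refine ⟨c, hc2.1, hc2.2.le, ?_⟩
    rw [hval] at hc1
    have h4 : D.μ.real {t | s' t < c} ≤ D.μ.real {t | s' t ≤ c} :=
      measureReal_mono fun t (ht : s' t < c) => ht.le
    have h5 : D.μ.real {t | s' t < c} - D.μ.real {t | s' t < B} < (1 - δ) * (b - a) / θ₀ := by
      linarith
    rw [lt_div_iff₀ (D.pos θ₀)] at h5
    linarith
  have hgap' : ∀ θ, a < s θ → c ≤ s θ := by
    intro θ hθ
    by_contra! h
    have h1 := hgap θ hθ
    have hle : θ ≤ θ₀ := by
      by_contra! h2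
      linarith [E.monotone h2.le]
    have hle' : (θ : ℝ) ≤ θ₀ := hle
    have h2 := E.best θ a ha.le
    have h3 := E.symm.le_cost ha.le hθ.le
    rw [E.winProb_eq ha, E.winProb_eq (ha.trans hθ)] at h2
    have h4 := real_lt_mono s' h.le
    have h5 := real_lt_mono s' (show a ≤ s θ by linarith)
    have h6 : (1 - δ) * (b - a) ≤ (1 - δ) * (s θ - a) :=
      mul_le_mul_of_nonneg_left (by linarith) (sub_nonneg.2 E.δ_lt.le)
    have h7 : (θ : ℝ) * (D.μ.real {t | s' t < s θ} - D.μ.real {t | s' t < a}) ≤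
        θ₀ * (D.μ.real {t | s' t < c} - D.μ.real {t | s' t < B}) := by
      refine mul_le_mul hle' ?_ (by linarith) (D.pos θ₀).le
      rw [hflatB]
      linarith
    linarith
  -- Some type of `s'` stops in `[B, c)`, although it would win as often at the midpoint of `a` and
  -- `b`.
  obtain ⟨d, ⟨hd, t, ht⟩, hdc⟩ :=
    exists_lt_of_csInf_lt (show S.Nonempty from ⟨c₀, hc₀, t₀, ht₀⟩) hcB
  have h1 := E.symm.winProb_lt t hmid.le (by rw [ht]; linarith)
  rw [E.symm.winProb_eq hmid, E.symm.winProb_eq (by rw [ht]; linarith), ht] at h1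
  refine absurd h1 (not_lt.2 (measureReal_mono fun θ (hθ : s θ < d) => ?_))
  by_contra h2
  have h3 : (a + b) / 2 ≤ s θ := not_lt.1 h2
  linarith [hgap' θ (by linarith)]

end IsRealEq

end TypeLaw

/-- The `min` and `max` allow the two bounds on the slope to swap roles with the sign of `b - a`. -/
lemma hasDerivAt_of_slope_between {g u v : ℝ → ℝ} {a L : ℝ}
    (hu : Tendsto u (𝓝[≠] a) (𝓝 L)) (hv : Tendsto v (𝓝[≠] a) (𝓝 L))
    (h : ∀ᶠ b in 𝓝[≠] a, min (u b) (v b) ≤ slope g a b ∧ slope g a b ≤ max (u b) (v b)) :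
    HasDerivAt g L a := by
  rw [hasDerivAt_iff_tendsto_slope]
  have h1 := hu.min hv
  have h2 := hu.max hv
  rw [min_self] at h1
  rw [max_self] at h2
  exact tendsto_of_tendsto_of_tendsto_of_le_of_le' h1 h2 (h.mono fun _ h => h.1)
    (h.mono fun _ h => h.2)

/-! ### Hazard rates of the stopping times and symmetry. -/

namespace TypeLaw

variable {D : TypeLaw}

/-- The probability that `s` stops strictly before `a`. -/
def timeCdf (s : D.Θ → ℝ) (a : ℝ) : ℝ := D.μ.real {t | s t < a}

lemma timeCdf_mono (s : D.Θ → ℝ) : Monotone (timeCdf s) := fun _ _ h => IsRealEq.real_lt_mono s h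

lemma timeCdf_le_one (s : D.Θ → ℝ) (a : ℝ) : timeCdf s a ≤ 1 := measureReal_le_one

lemma timeCdf_nonneg (s : D.Θ → ℝ) (a : ℝ) : 0 ≤ timeCdf s a := measureReal_nonneg

namespace IsRealEq

variable {δ : ℝ} {s s' : D.Θ → ℝ}

/-- Waiting beyond a sure victory is wasteful. Equality is impossible because a higher type would
have to share the time `a`. -/
lemma lt_of_timeCdf_eq_one (E : IsRealEq δ s s') {a : ℝ} (ha : 0 < a) (h : timeCdf s' a = 1)
    (θ : D.Θ) : s θ < a := by
  have hle : ∀ θ, s θ ≤ a := by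
    intro θ
    by_contra! h1
    have h2 := E.winProb_lt θ ha.le h1
    rw [E.winProb_eq ha, E.winProb_eq (ha.trans h1)] at h2
    have := timeCdf_le_one s' (s θ)
    simp only [timeCdf] at h this
    linarith
  refine (hle θ).lt_of_ne fun h1 => ?_
  obtain ⟨t, ht, -⟩ := D.exists_gt_of_pos θ one_pos
  have h2 : s θ = s t := le_antisymm (E.monotone ht.le) (h1 ▸ hle t)
  exact ht.ne (E.symm.inj (h1 ▸ ha) h2)

lemma timeCdf_eq_one (E : IsRealEq δ s s') {a : ℝ} (ha : 0 < a) (h : timeCdf s' a = 1) :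
    timeCdf s a = 1 := by
  rw [timeCdf, eq_univ_of_forall (s := {t | s t < a}) (E.lt_of_timeCdf_eq_one ha h), probReal_univ]

/-- The times at which the game has not ended yet with certainty. -/
def times (s : D.Θ → ℝ) : Set ℝ := {a | 0 < a ∧ timeCdf s a < 1}

lemma times_subset (E : IsRealEq δ s s') : times s ⊆ times s' := fun _ ha =>
  ⟨ha.1, lt_of_le_of_ne (timeCdf_le_one _ _) fun h => ha.2.ne (E.timeCdf_eq_one ha.1 h)⟩

lemma timeCdf_eq_cdf (E : IsRealEq δ s s') {θ : D.Θ} (h : 0 < s θ) :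
    timeCdf s (s θ) = D.cdfΘ θ := E.symm.real_lt_eq_cdf h

lemma mem_times (E : IsRealEq δ s s') {θ : D.Θ} (h : 0 < s θ) : s θ ∈ times s :=
  ⟨h, by rw [E.timeCdf_eq_cdf h]; exact D.cdfΘ_lt_one θ⟩

lemma timeCdf_lt (E : IsRealEq δ s s') {a b : ℝ} (ha : a ∈ times s) (hab : a < b) :
    timeCdf s a < timeCdf s b :=
  (timeCdf_mono s hab.le).lt_of_ne fun h => ha.2.ne (E.symm.eq_one_of_flat ha.1 hab h)

lemma mem_times_of_le {a b : ℝ} (ha : 0 < a) (hab : a ≤ b) (hb : b ∈ times s) : a ∈ times s :=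
  ⟨ha, (timeCdf_mono s hab).trans_lt hb.2⟩

/-- Every such time is the stopping time of some type. -/
lemma exists_type (E : IsRealEq δ s s') {a : ℝ} (ha : a ∈ times s) : ∃ θ, s θ = a := by
  have hex : ∃ θ, a ≤ s θ := by
    by_contra! h
    refine ha.2.ne ?_
    rw [timeCdf, eq_univ_of_forall (s := {t | s t < a}) h, probReal_univ]
  have hex' : ∃ θ, s θ < a := by
    by_contra! h
    have h1 : timeCdf s (a / 2) < timeCdf s a :=
      E.timeCdf_lt (mem_times_of_le (by linarith [ha.1]) (by linarith [ha.1]) ha)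
        (by linarith [ha.1])
    have h2 : timeCdf s a = 0 := by
      rw [timeCdf, show {t | s t < a} = ∅ from
        eq_empty_iff_forall_notMem.2 fun θ hθ => not_lt.2 (h θ) hθ, measureReal_empty]
    linarith [timeCdf_nonneg s (a / 2)]
  obtain ⟨θ₁, hθ₁⟩ := hex
  obtain ⟨θ₀, hθ₀⟩ := hex'
  set A : Set ℝ := Subtype.val '' {θ : D.Θ | s θ < a} with hA
  have hub : ∀ x ∈ A, x ≤ θ₁ := by
    rintro _ ⟨θ, hθ, rfl⟩
    by_contra! h
    have h1 : s θ < a := hθ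
    linarith [E.monotone (show θ₁ ≤ θ from h.le)]
  have hbdd : BddAbove A := ⟨θ₁, hub⟩
  have hne : A.Nonempty := ⟨θ₀, θ₀, hθ₀, rfl⟩
  have hmem : sSup A ∈ D.Θ := D.ordConnected_Θ.out θ₀.2 θ₁.2
    ⟨le_csSup hbdd ⟨θ₀, hθ₀, rfl⟩, csSup_le hne hub⟩
  -- The supremum of the types stopping before `a` stops exactly at `a`: on either side of `a`, a
  -- different value would leave an interval in which nobody stops.
  refine ⟨⟨sSup A, hmem⟩, ?_⟩
  set x : D.Θ := ⟨sSup A, hmem⟩ with hx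
  rcases lt_trichotomy (s x) a with h | h | h
  · exfalso
    have hc : 0 < (s x + a) / 2 := by linarith [E.nonneg x, ha.1]
    have h1 := E.timeCdf_lt (mem_times_of_le hc (by linarith) ha)
      (show (s x + a) / 2 < a by linarith)
    refine absurd h1 (not_lt.2 (measureReal_mono fun θ hθ => ?_))
    have h2 : θ ≤ x := le_csSup hbdd ⟨θ, hθ, rfl⟩
    have h3 := E.monotone h2
    change s θ < _
    linarith
  · exact h
  · exfalso
    refine absurd (E.timeCdf_lt ha h) (not_lt.2 (measureReal_mono fun θ hθ => ?_))
    have h1 : θ < x := by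
      by_contra! h2
      exact absurd hθ (not_lt.2 (E.monotone h2))
    obtain ⟨_, ⟨θ', hθ', rfl⟩, h3⟩ := exists_lt_of_lt_csSup hne (show (θ : ℝ) < sSup A from h1)
    exact (E.monotone (show θ ≤ θ' from h3.le)).trans_lt hθ'

/-- The first-order condition, in finite form. -/
lemma mul_timeCdf_sub_le (E : IsRealEq δ s s') {θ : D.Θ} {b : ℝ} (hθ : 0 < s θ) (hb : 0 < b) :
    θ * (timeCdf s' b - timeCdf s' (s θ)) ≤ expCost δ s' b - expCost δ s' (s θ) := by
  have h := E.best θ b hb.le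
  rw [E.winProb_eq hb, E.winProb_eq hθ] at h
  simp only [timeCdf]
  linarith

/-- Types stopping after `a / 2` are at least some `θ₀ > 0`, so the first-order condition gives a
Lipschitz bound with constant `1 / θ₀`. -/
lemma continuousAt_timeCdf (E : IsRealEq δ s s') {a : ℝ} (ha : a ∈ times s) :
    ContinuousAt (timeCdf s') a := by
  have hprob : IsProbabilityMeasure (D.μ.map s') :=
    Measure.isProbabilityMeasure_map E.meas'.aemeasurable
  obtain ⟨θ, rfl⟩ := E.exists_type ha
  obtain ⟨θ₀, hθ₀⟩ := E.exists_type
    (mem_times_of_le (by linarith [ha.1] : 0 < s θ / 2) (by linarith [ha.1]) ha)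
  have hp := D.pos θ₀
  have hle : (θ₀ : ℝ) ≤ θ := by
    have : θ₀ ≤ θ := by
      by_contra! h
      linarith [E.monotone h.le, ha.1]
    exact this
  have hbound : ∀ b ∈ Ioi (s θ / 2),
      ‖timeCdf s' b - timeCdf s' (s θ)‖ ≤ ‖b - s θ‖ / θ₀ := by
    intro b hb
    have hb : s θ / 2 < b := hb
    have hb0 : 0 < b := by linarith [ha.1]
    rw [Real.norm_eq_abs, Real.norm_eq_abs, le_div_iff₀ hp]
    rcases le_total (s θ) b with h | h
    · rw [abs_of_nonneg (sub_nonneg.2 (timeCdf_mono s' h)), abs_of_nonneg (sub_nonneg.2 h)]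
      have h1 := E.mul_timeCdf_sub_le ha.1 hb0
      have h2 := E.symm.cost_le ha.1.le h
      have h3 := timeCdf_mono s' h
      nlinarith
    · rw [abs_of_nonpos (sub_nonpos.2 (timeCdf_mono s' h)), abs_of_nonpos (sub_nonpos.2 h)]
      obtain ⟨t, rfl⟩ := E.exists_type (mem_times_of_le hb0 h ha)
      have h1 := E.mul_timeCdf_sub_le hb0 ha.1
      have h2 := E.symm.cost_le hb0.le h
      have h3 := timeCdf_mono s' h
      have h4 : (θ₀ : ℝ) ≤ t := by
        have : θ₀ ≤ t := by
          by_contra! h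
          linarith [E.monotone h.le]
        exact this
      nlinarith
  rw [ContinuousAt, tendsto_iff_norm_sub_tendsto_zero]
  refine squeeze_zero' (Eventually.of_forall fun _ => norm_nonneg _)
    ((Ioi_mem_nhds (show s θ / 2 < s θ by linarith [ha.1])) |> fun h =>
      Filter.mem_of_superset h hbound) ?_
  have : Tendsto (fun b => ‖b - s θ‖ / θ₀) (𝓝 (s θ)) (𝓝 (‖s θ - s θ‖ / θ₀)) :=
    ((continuous_id.sub continuous_const).norm.div_const _).tendsto _
  simpa using this

lemma isOpen_times (E : IsRealEq δ s s') : IsOpen (times s) := by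
  rw [isOpen_iff_mem_nhds]
  intro a ha
  filter_upwards [lt_mem_nhds ha.1,
    (E.symm.continuousAt_timeCdf (E.times_subset ha)).eventually_lt_const ha.2] with b h1 h2
  exact ⟨h1, h2⟩

lemma hasDerivAt_expCost (E : IsRealEq δ s s') {a : ℝ} (ha : a ∈ times s) :
    HasDerivAt (expCost δ s') (1 - δ * timeCdf s' a) a := by
  have hc := (E.continuousAt_timeCdf ha).tendsto.mono_left (nhdsWithin_le_nhds (s := {a}ᶜ))
  refine hasDerivAt_of_slope_between (u := fun b => 1 - δ * timeCdf s' b)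
    (tendsto_const_nhds.sub (hc.const_mul δ))
    (v := fun b => 1 - δ * timeCdf s' a) tendsto_const_nhds ?_
  filter_upwards [nhdsWithin_le_nhds (lt_mem_nhds ha.1), self_mem_nhdsWithin] with b hb hne
  rw [slope_def_field]
  rcases lt_or_gt_of_ne (show b ≠ a from hne) with h | h
  · obtain ⟨h1, h2⟩ := expCost_sub_bounds E.δ_pos E.meas' E.nonneg' hb.le h.le
    rw [← neg_div_neg_eq, neg_sub, neg_sub]
    refine ⟨(min_le_right _ _).trans ?_, le_trans ?_ (le_max_left _ _)⟩
    · rw [le_div_iff₀ (by linarith)]; simp only [timeCdf]; linarith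
    · rw [div_le_iff₀ (by linarith)]; simp only [timeCdf]; linarith
  · obtain ⟨h1, h2⟩ := expCost_sub_bounds E.δ_pos E.meas' E.nonneg' ha.1.le (le_of_lt h)
    refine ⟨(min_le_left _ _).trans ?_, le_trans ?_ (le_max_right _ _)⟩
    · rw [le_div_iff₀ (by linarith)]; simp only [timeCdf]; linarith
    · rw [div_le_iff₀ (by linarith)]; simp only [timeCdf]; linarith

/-- The first-order condition: the hazard rate of the opponent at the stopping time of a type. -/
lemma hasDerivAt_timeCdf (E : IsRealEq δ s s') {θ : D.Θ} (hθ : 0 < s θ) :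
    HasDerivAt (timeCdf s') ((1 - δ * timeCdf s' (s θ)) / θ) (s θ) := by
  set a := s θ with ha_def
  have ha : a ∈ times s := E.mem_times hθ
  -- `Φ` inverts `s` on `times s`; elsewhere its value is arbitrary.
  have hex : ∀ b, ∃ t : D.Θ, b ∈ times s → s t = b := fun b => by
    by_cases hb : b ∈ times s
    · exact (E.exists_type hb).imp fun _ h _ => h
    · exact ⟨θ, fun h => absurd h hb⟩
  choose Φ hΦ using hex
  have hev : ∀ᶠ b in 𝓝[≠] a, b ∈ times s :=
    nhdsWithin_le_nhds (E.isOpen_times.mem_nhds ha)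
  have hΦcont : Tendsto (fun b => (Φ b : ℝ)) (𝓝[≠] a) (𝓝 θ) := by
    rw [Metric.tendsto_nhds]
    intro r hr
    obtain ⟨t₁, h1, h1'⟩ := D.exists_gt_of_pos θ hr
    obtain ⟨t₀, h0, h0'⟩ := D.exists_lt_of_pos θ hr
    have hs1 : a < s t₁ := (E.monotone h1.le).lt_of_ne fun h => h1.ne (E.symm.inj hθ h)
    have hs0 : s t₀ < a := (E.monotone h0.le).lt_of_ne fun h => h0.ne' (E.symm.inj hθ h.symm)
    filter_upwards [hev, nhdsWithin_le_nhds (Ioo_mem_nhds hs0 hs1)] with b hb hb'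
    have e := hΦ b hb
    have g1 : (Φ b : ℝ) < t₁ := by
      by_contra! h
      linarith [E.monotone (show t₁ ≤ Φ b from h), hb'.2]
    have g0 : (t₀ : ℝ) < Φ b := by
      by_contra! h
      linarith [E.monotone (show Φ b ≤ t₀ from h), hb'.1]
    rw [Real.dist_eq, abs_lt]
    constructor <;> linarith
  have hsl := hasDerivAt_iff_tendsto_slope.1 (E.hasDerivAt_expCost ha)
  have hp := D.pos θ
  -- Optimality of `θ` against time `b`, and of `Φ b` against time `a`, traps the slope between the
  -- cost slope divided by `θ` and by `Φ b`.
  refine hasDerivAt_of_slope_between (hsl.div_const (θ : ℝ)) (hsl.div hΦcont hp.ne') ?_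
  filter_upwards [hev, self_mem_nhdsWithin] with b hb hne
  have h1 := E.mul_timeCdf_sub_le hθ hb.1
  have e := hΦ b hb
  have h2 := E.mul_timeCdf_sub_le (θ := Φ b) (by rw [e]; exact hb.1) hθ
  rw [e] at h2
  have hpb := D.pos (Φ b)
  simp only [Pi.div_apply, slope_def_field]
  rw [div_right_comm, div_right_comm _ _ (Φ b : ℝ)]
  rcases lt_or_gt_of_ne (show b ≠ a from hne) with h | h
  · have hn : b - a < 0 := by linarith
    refine ⟨(min_le_left _ _).trans ?_, le_trans ?_ (le_max_right _ _)⟩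
    · refine div_le_div_of_nonpos_of_le hn.le ?_
      rw [le_div_iff₀ hp]; linarith
    · refine div_le_div_of_nonpos_of_le hn.le ?_
      rw [div_le_iff₀ hpb]; linarith
  · have hn : 0 < b - a := by linarith
    refine ⟨(min_le_right _ _).trans ?_, le_trans ?_ (le_max_left _ _)⟩
    · refine div_le_div_of_nonneg_right ?_ hn.le
      rw [div_le_iff₀ hpb]; linarith
    · refine div_le_div_of_nonneg_right ?_ hn.le
      rw [le_div_iff₀ hp]; linarith

lemma one_sub_pos (E : IsRealEq δ s s') (a : ℝ) : 0 < 1 - δ * timeCdf s a := by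
  have h1 := timeCdf_le_one s a
  have h2 := timeCdf_nonneg s a
  nlinarith [E.δ_pos, E.δ_lt]

/-- Both players stop at the same rate. -/
lemma timeCdf_eq (E : IsRealEq δ s s') {a : ℝ} (ha : a ∈ times s) :
    timeCdf s a = timeCdf s' a := by
  set L : ℝ → ℝ := fun b => Real.log (1 - δ * timeCdf s b) - Real.log (1 - δ * timeCdf s' b)
    with hL
  have hderiv : ∀ b ∈ times s, ∃ θ θ' : D.Θ, timeCdf s b = D.cdfΘ θ ∧ timeCdf s' b = D.cdfΘ θ' ∧
      HasDerivAt L (δ * (1 / θ - 1 / θ')) b := by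
    intro b hb
    obtain ⟨θ, hθ⟩ := E.exists_type hb
    obtain ⟨θ', hθ'⟩ := E.symm.exists_type (E.times_subset hb)
    have hb0 : 0 < b := hb.1
    refine ⟨θ, θ', ?_, ?_, ?_⟩
    · rw [← hθ, E.timeCdf_eq_cdf (hθ ▸ hb0)]
    · rw [← hθ', E.symm.timeCdf_eq_cdf (hθ' ▸ hb0)]
    · have d1 := E.hasDerivAt_timeCdf (θ := θ) (hθ ▸ hb0)
      have d2 := E.symm.hasDerivAt_timeCdf (θ := θ') (hθ' ▸ hb0)
      rw [hθ] at d1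
      rw [hθ'] at d2
      have p1 := E.one_sub_pos b
      have p2 := E.symm.one_sub_pos b
      have e1 := ((d1.const_mul δ).const_sub 1).log p2.ne'
      have e2 := ((d2.const_mul δ).const_sub 1).log p1.ne'
      refine (e2.sub e1).congr_deriv ?_
      have := (D.pos θ).ne'
      have := (D.pos θ').ne'
      field_simp
      ring
  have hconv : Convex ℝ (times s) := by
    refine OrdConnected.convex ⟨fun x hx y hy z hz => ?_⟩
    exact mem_times_of_le (hx.1.trans_le hz.1) hz.2 hy
  -- `L` and its derivative have the same sign, because the player whose stopping type is lower has
  -- the lower distribution function.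
  have hmono : MonotoneOn (fun b => L b ^ 2) (times s) := by
    refine monotoneOn_of_deriv_nonneg hconv (fun b hb => ?_) (fun b hb => ?_) fun b hb => ?_
    · obtain ⟨_, _, _, _, h⟩ := hderiv b hb
      exact (h.pow 2).continuousAt.continuousWithinAt
    · obtain ⟨_, _, _, _, h⟩ := hderiv b (interior_subset hb)
      exact (h.pow 2).differentiableAt.differentiableWithinAt
    · obtain ⟨θ, θ', h1, h2, h⟩ := hderiv b (interior_subset hb)
      have hd : deriv (fun b => L b ^ 2) b = _ := (h.pow 2).deriv
      rw [hd]
      have p1 := E.one_sub_pos b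
      have p2 := E.symm.one_sub_pos b
      have hδ := E.δ_pos
      rcases le_total θ θ' with hle | hle
      · have c1 : timeCdf s b ≤ timeCdf s' b := by
          rw [h1, h2]; exact D.cdfΘ_strictMono.monotone hle
        have c2 : 0 ≤ L b := sub_nonneg.2 (Real.log_le_log p2 (by nlinarith))
        have c3 : (1 : ℝ) / θ' ≤ 1 / θ := one_div_le_one_div_of_le (D.pos θ) hle
        have c4 : 0 ≤ (1 : ℝ) / θ - 1 / θ' := sub_nonneg.2 c3
        positivity
      · have c1 : timeCdf s' b ≤ timeCdf s b := by
          rw [h1, h2]; exact D.cdfΘ_strictMono.monotone hle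
        have c2 : L b ≤ 0 := sub_nonpos.2 (Real.log_le_log p1 (by nlinarith))
        have c3 : (1 : ℝ) / θ ≤ 1 / θ' := one_div_le_one_div_of_le (D.pos θ') hle
        have c5 := mul_nonneg_of_nonpos_of_nonpos c2 (mul_nonpos_of_nonneg_of_nonpos hδ.le
          (sub_nonpos.2 c3))
        simp only [Nat.cast_ofNat, Nat.add_one_sub_one, pow_one]
        linarith
  have hzero : L a ^ 2 ≤ 0 := by
    obtain ⟨θ₁, hθ₁⟩ := E.exists_type ha
    obtain ⟨θ₂, hθ₂⟩ := E.symm.exists_type (E.times_subset ha)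
    -- along the stopping times of high types both distribution functions tend to one
    have hev : ∀ᶠ θ in (atTop : Filter D.Θ), L a ^ 2 ≤
        (|Real.log (1 - δ * D.cdfΘ θ) - Real.log (1 - δ * 1)|) ^ 2 := by
      filter_upwards [eventually_ge_atTop θ₁, eventually_ge_atTop θ₂] with θ h1 h2
      have g1 : a ≤ s θ := hθ₁ ▸ E.monotone h1
      have g2 : a ≤ s' θ := hθ₂ ▸ E.symm.monotone h2
      have a0 := ha.1
      have m1 : s θ ∈ times s := E.mem_times (by linarith)
      have m2 : s' θ ∈ times s := E.symm.times_subset (E.symm.mem_times (by linarith))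
      -- At the later of the two times, both distribution functions are at least the quantile of
      -- `θ`.
      set b := max (s θ) (s' θ) with hb
      have hbm : b ∈ times s := by
        rcases max_choice (s θ) (s' θ) with h | h <;> rw [hb, h] <;> assumption
      refine (hmono ha hbm (g1.trans (le_max_left _ _))).trans ?_
      have k1 : D.cdfΘ θ ≤ timeCdf s b := by
        rw [← E.timeCdf_eq_cdf (by linarith)]; exact timeCdf_mono s (le_max_left _ _)
      have k2 : D.cdfΘ θ ≤ timeCdf s' b := by
        rw [← E.symm.timeCdf_eq_cdf (by linarith)]; exact timeCdf_mono s' (le_max_right _ _)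
      have hδ := E.δ_pos
      have hδ' := E.δ_lt
      have u1 := timeCdf_le_one s b
      have u2 := timeCdf_le_one s' b
      have l1 : Real.log (1 - δ * timeCdf s b) ≤ Real.log (1 - δ * D.cdfΘ θ) :=
        Real.log_le_log (E.one_sub_pos b) (by nlinarith)
      have l2 : Real.log (1 - δ * timeCdf s' b) ≤ Real.log (1 - δ * D.cdfΘ θ) :=
        Real.log_le_log (E.symm.one_sub_pos b) (by nlinarith)
      have l3 : Real.log (1 - δ * 1) ≤ Real.log (1 - δ * timeCdf s b) :=
        Real.log_le_log (by linarith) (by nlinarith)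
      have l4 : Real.log (1 - δ * 1) ≤ Real.log (1 - δ * timeCdf s' b) :=
        Real.log_le_log (by linarith) (by nlinarith)
      rw [sq_le_sq, abs_abs, abs_of_nonneg (show 0 ≤ Real.log (1 - δ * D.cdfΘ θ) -
        Real.log (1 - δ * 1) by linarith), abs_le]
      constructor <;> simp only [hL] <;> linarith
    have hlim : Tendsto (fun θ : D.Θ =>
        (|Real.log (1 - δ * D.cdfΘ θ) - Real.log (1 - δ * 1)|) ^ 2) atTop (𝓝 0) := by
      have h1 : Tendsto (fun θ : D.Θ => Real.log (1 - δ * D.cdfΘ θ)) atTop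
          (𝓝 (Real.log (1 - δ * 1))) :=
        (tendsto_const_nhds.sub (D.tendsto_cdfΘ_atTop.const_mul δ)).log
          (by linarith [E.δ_lt])
      have h2 := (h1.sub_const (Real.log (1 - δ * 1))).abs.pow 2
      simpa using h2
    exact ge_of_tendsto hlim hev
  have hLa : L a = 0 := pow_eq_zero_iff two_ne_zero |>.1 (le_antisymm hzero (sq_nonneg _))
  have hlog := Real.log_injOn_pos (E.one_sub_pos a) (E.symm.one_sub_pos a) (sub_eq_zero.1 hLa)
  have := E.δ_pos
  nlinarith [mul_left_cancel₀ this.ne' (show δ * timeCdf s a = δ * timeCdf s' a by linarith)]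

/-- Equilibria are symmetric. -/
theorem eq (E : IsRealEq δ s s') (hpos : ∀ t, 0 < s' t) : s = s' := by
  funext t
  have h2 := E.symm.times_subset (E.symm.mem_times (hpos t))
  obtain ⟨θ, hθ⟩ := E.exists_type h2
  have h3 := E.timeCdf_eq h2
  rw [E.symm.timeCdf_eq_cdf (hpos t)] at h3
  nth_rewrite 1 [← hθ] at h3
  rw [E.timeCdf_eq_cdf (hθ ▸ hpos t)] at h3
  rwa [D.cdfΘ_strictMono.injective h3] at hθ

end IsRealEq

end TypeLaw

/-! ### Payoffs at finite stopping times -/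

lemma expect_coe {T : Type*} [MeasurableSpace T] {m : Measure T} {X : T → ℝ}
    (hX : Integrable X m) : expect m (fun t => (X t : EReal)) = ((∫ t, X t ∂m : ℝ) : EReal) := by
  have h1 : ∀ x : ℝ, (x : EReal).toENNReal = ENNReal.ofReal x := fun x => by simp
  have h2 : ∀ x : ℝ, (-(x : EReal)).toENNReal = ENNReal.ofReal (-x) := fun x => by
    rw [← EReal.coe_neg, h1]
  have f1 : ∫⁻ t, ENNReal.ofReal (X t) ∂m ≠ ∞ := hX.lintegral_lt_top.ne
  have f2 : ∫⁻ t, ENNReal.ofReal (-X t) ∂m ≠ ∞ := hX.neg.lintegral_lt_top.ne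
  simp only [expect, h1, h2]
  rw [integral_eq_lintegral_pos_part_sub_lintegral_neg_part hX, EReal.coe_sub,
    EReal.coe_ennreal_toReal f1, EReal.coe_ennreal_toReal f2]

lemma expect_eq_bot {T : Type*} [MeasurableSpace T] {m : Measure T} {X : T → EReal}
    (h : ∫⁻ t, (-X t).toENNReal ∂m = ∞) : expect m X = ⊥ := by
  rw [expect, h, EReal.coe_ennreal_top, sub_eq_add_neg, EReal.neg_top, EReal.add_bot]

lemma expect_mono {T : Type*} [MeasurableSpace T] {m : Measure T} {X Y : T → EReal}
    (h : ∀ t, X t ≤ Y t) : expect m X ≤ expect m Y := by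
  refine EReal.sub_le_sub ?_ ?_
  · exact EReal.coe_ennreal_le_coe_ennreal_iff.2
      (lintegral_mono fun t => EReal.toENNReal_le_toENNReal (h t))
  · exact EReal.coe_ennreal_le_coe_ennreal_iff.2
      (lintegral_mono fun t => EReal.toENNReal_le_toENNReal (EReal.neg_le_neg_iff.2 (h t)))

/-- The share of the prize of a player who stops at `a` against `b`. -/
def winShare (a b : ℝ≥0∞) : ℝ := if b < a then 1 else if a = b then 1 / 2 else 0

/-- The Amann--Leininger payoff of a finite stopping time, as a real number. -/
def realPayoff (δ θ : ℝ) (a b : ℝ≥0∞) : ℝ :=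
  θ * winShare a b - (δ * (min a b).toReal + (1 - δ) * a.toReal)

lemma alPayoff_eq_coe {δ : ℝ} (h0 : 0 ≤ δ) (h1 : δ ≤ 1) (θ : ℝ) {a : ℝ≥0∞} (ha : a ≠ ∞)
    (b : ℝ≥0∞) : alPayoff δ θ a b = (realPayoff δ θ a b : EReal) := by
  unfold alPayoff realPayoff winShare
  by_cases h : b < a
  · have hb : b ≠ ∞ := h.ne_top
    have hfin : ENNReal.ofReal δ * b + ENNReal.ofReal (1 - δ) * a ≠ ∞ :=
      ENNReal.add_ne_top.2 ⟨ENNReal.mul_ne_top ENNReal.ofReal_ne_top hb,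
        ENNReal.mul_ne_top ENNReal.ofReal_ne_top ha⟩
    rw [if_pos h, if_pos h, ← EReal.coe_ennreal_toReal hfin, ← EReal.coe_sub, min_eq_right h.le,
      ENNReal.toReal_add (ENNReal.mul_ne_top ENNReal.ofReal_ne_top hb)
        (ENNReal.mul_ne_top ENNReal.ofReal_ne_top ha), ENNReal.toReal_mul, ENNReal.toReal_mul,
      ENNReal.toReal_ofReal h0, ENNReal.toReal_ofReal (sub_nonneg.2 h1), mul_one]
  · rw [if_neg h, if_neg h, min_eq_left (not_lt.1 h), ← EReal.coe_ennreal_toReal ha]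
    split_ifs
    · rw [← EReal.coe_sub]; congr 1; ring
    · rw [← EReal.coe_neg]; congr 1; ring

lemma alPayoff_top {δ : ℝ} (h1 : δ < 1) (θ : ℝ) (b : ℝ≥0∞) : alPayoff δ θ ∞ b = ⊥ := by
  unfold alPayoff
  have : ENNReal.ofReal δ * b + ENNReal.ofReal (1 - δ) * ∞ = ∞ := by
    rw [ENNReal.mul_top (by simpa using h1), add_top]
  rw [this]
  by_cases h : b < ∞
  · rw [if_pos h, EReal.coe_ennreal_top, sub_eq_add_neg, EReal.neg_top, EReal.add_bot]
  · rw [if_neg h, if_pos (top_le_iff.1 (not_lt.1 h)).symm, EReal.coe_ennreal_top, sub_eq_add_neg,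
      EReal.neg_top, EReal.add_bot]

/-- Lets the real-valued payoff formula serve the original and the crazy-types game as well. -/
lemma basePayoff_eq_alPayoff_one (θ : ℝ) (a b : ℝ≥0∞) : basePayoff θ a b = alPayoff 1 θ a b := by
  simp [basePayoff, alPayoff]

lemma basePayoff_top_top (θ : ℝ) : basePayoff θ ∞ ∞ = ⊥ := by
  simp [basePayoff, sub_eq_add_neg]

lemma measurable_realPayoff {T : Type*} [MeasurableSpace T] (δ θ : ℝ) (a : ℝ≥0∞)
    {σ : T → ℝ≥0∞} (hσ : Measurable σ) : Measurable fun t => realPayoff δ θ a (σ t) := by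
  unfold realPayoff winShare
  refine (Measurable.const_mul ?_ _).sub
    (((measurable_const.min hσ).ennreal_toReal.const_mul _).add measurable_const)
  refine Measurable.ite (measurableSet_lt hσ measurable_const) measurable_const
    (Measurable.ite ?_ measurable_const measurable_const)
  exact measurableSet_eq_fun measurable_const hσ

lemma winShare_mem (a b : ℝ≥0∞) : 0 ≤ winShare a b ∧ winShare a b ≤ 1 := by
  unfold winShare
  split_ifs <;> norm_num

lemma integrable_realPayoff {T : Type*} [MeasurableSpace T] {m : Measure T} [IsFiniteMeasure m]
    (δ θ : ℝ) {a : ℝ≥0∞} (ha : a ≠ ∞) {σ : T → ℝ≥0∞} (hσ : Measurable σ) :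
    Integrable (fun t => realPayoff δ θ a (σ t)) m := by
  refine Integrable.of_bound (measurable_realPayoff δ θ a hσ).aestronglyMeasurable
    (|θ| + (|δ| * a.toReal + |1 - δ| * a.toReal)) (Eventually.of_forall fun t => ?_)
  obtain ⟨h0, h1⟩ := winShare_mem a (σ t)
  have h2 : (min a (σ t)).toReal ≤ a.toReal := ENNReal.toReal_mono ha (min_le_left _ _)
  unfold realPayoff
  refine (norm_sub_le _ _).trans (add_le_add ?_ ((norm_add_le _ _).trans (add_le_add ?_ ?_)))
  · rw [norm_mul, Real.norm_eq_abs, Real.norm_of_nonneg h0]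
    exact mul_le_of_le_one_right (abs_nonneg _) h1
  · rw [norm_mul, Real.norm_eq_abs, Real.norm_of_nonneg ENNReal.toReal_nonneg]
    exact mul_le_mul_of_nonneg_left h2 (abs_nonneg _)
  · rw [norm_mul, Real.norm_eq_abs, Real.norm_of_nonneg ENNReal.toReal_nonneg]

/-- When stopping at `∞` is worth `⊥`, optimality reduces to a comparison of real values at finite
times. -/
lemma forall_ite_bot_le_iff (V : ℝ≥0∞ → ℝ) (x : ℝ≥0∞) :
    (∀ a, (if a = ∞ then (⊥ : EReal) else (V a : EReal)) ≤ if x = ∞ then ⊥ else (V x : EReal)) ↔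
      x ≠ ∞ ∧ ∀ a, a ≠ ∞ → V a ≤ V x := by
  constructor
  · intro h
    have hx : x ≠ ∞ := by
      intro hx
      have := h 0
      simp [hx] at this
    refine ⟨hx, fun a ha => ?_⟩
    have := h a
    rwa [if_neg ha, if_neg hx, EReal.coe_le_coe_iff] at this
  · rintro ⟨hx, h⟩ a
    by_cases ha : a = ∞
    · simp [ha]
    · rw [if_neg ha, if_neg hx]
      exact EReal.coe_le_coe_iff.2 (h a ha)

namespace TypeLaw

variable (D : TypeLaw)

/-- Expected payoff of the type `θ` stopping at the finite time `a` against `σ` in the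
Amann--Leininger game. -/
def alValue (δ θ : ℝ) (σ : D.Θ → ℝ≥0∞) (a : ℝ≥0∞) : ℝ := ∫ t, realPayoff δ θ a (σ t) ∂D.μ

variable {D}

lemma expect_alPayoff {δ : ℝ} (h0 : 0 ≤ δ) (h1 : δ < 1) (θ : ℝ) {σ : D.Θ → ℝ≥0∞}
    (hσ : Measurable σ) (a : ℝ≥0∞) :
    expect D.μ (fun t => alPayoff δ θ a (σ t)) =
      if a = ∞ then ⊥ else (D.alValue δ θ σ a : EReal) := by
  split_ifs with ha
  · subst ha
    refine expect_eq_bot ?_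
    simp [alPayoff_top h1]
  · simp only [alPayoff_eq_coe h0 h1.le θ ha]
    exact expect_coe (integrable_realPayoff δ θ ha hσ)

lemma isBestResponse_al_iff {δ : ℝ} (h0 : 0 ≤ δ) (h1 : δ < 1) {σ σ' : D.Θ → ℝ≥0∞}
    (hσ' : Measurable σ') :
    IsBestResponse D.μ (fun θ : D.Θ => alPayoff δ θ) σ σ' ↔
      ∀ θ, σ θ ≠ ∞ ∧ ∀ a, a ≠ ∞ → D.alValue δ θ σ' a ≤ D.alValue δ θ σ' (σ θ) := by
  unfold IsBestResponse
  refine forall_congr' fun θ => ?_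
  simp only [expect_alPayoff h0 h1 θ hσ']
  exact forall_ite_bot_le_iff _ _

/-! ### Crazy types -/

lemma btLaw_eq (ε : ℝ) : D.btLaw ε = ENNReal.ofReal (1 - ε) • D.μ.map (fun t => (t, false)) +
    ENNReal.ofReal ε • D.μ.map (fun t => (t, true)) := by
  rw [btLaw, Measure.prod_add, Measure.prod_smul_right, Measure.prod_smul_right,
    Measure.prod_dirac, Measure.prod_dirac]

instance isFiniteMeasure_btLaw (ε : ℝ) : IsFiniteMeasure (D.btLaw ε) := by
  have (b : Bool) : IsProbabilityMeasure (D.μ.map fun t => (t, b)) :=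
    Measure.isProbabilityMeasure_map (by fun_prop)
  refine ⟨?_⟩
  rw [btLaw_eq]
  simp

lemma lintegral_btLaw (ε : ℝ) {g : D.Θ × Bool → ℝ≥0∞} (hg : Measurable g) :
    ∫⁻ t, g t ∂(D.btLaw ε) = ENNReal.ofReal (1 - ε) * ∫⁻ t, g (t, false) ∂D.μ +
      ENNReal.ofReal ε * ∫⁻ t, g (t, true) ∂D.μ := by
  rw [btLaw_eq, lintegral_add_measure, lintegral_smul_measure, lintegral_smul_measure,
    lintegral_map hg (by fun_prop), lintegral_map hg (by fun_prop)]
  rfl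

lemma integral_btLaw {ε : ℝ} (h0 : 0 ≤ ε) (h1 : ε ≤ 1) {g : D.Θ × Bool → ℝ}
    (hgm : Measurable g) (hg : Integrable g (D.btLaw ε)) :
    ∫ t, g t ∂(D.btLaw ε) = (1 - ε) * ∫ t, g (t, false) ∂D.μ + ε * ∫ t, g (t, true) ∂D.μ := by
  rw [btLaw_eq] at hg ⊢
  rw [integral_add_measure hg.left_of_add_measure hg.right_of_add_measure,
    integral_smul_measure, integral_smul_measure,
    integral_map (by fun_prop) hgm.aestronglyMeasurable,
    integral_map (by fun_prop) hgm.aestronglyMeasurable,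
    ENNReal.toReal_ofReal (sub_nonneg.2 h1), ENNReal.toReal_ofReal h0]
  rfl

lemma measurable_withCrazy_iff (σ : D.Θ → ℝ≥0∞) : Measurable (withCrazy σ) ↔ Measurable σ := by
  constructor
  · intro h
    exact h.comp (f := fun t => (t, false)) (by fun_prop)
  · intro h
    refine Measurable.ite ?_ measurable_const (h.comp measurable_fst)
    exact measurable_snd (measurableSet_singleton true)

lemma winShare_smul {c : ℝ≥0∞} (hc : c ≠ 0) (hc' : c ≠ ∞) (a b : ℝ≥0∞) :
    winShare (c * a) (c * b) = winShare a b := by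
  simp only [winShare, ENNReal.mul_lt_mul_iff_right hc hc', ENNReal.mul_right_inj hc hc']

/-- Payoffs in the game with crazy types are those of the Amann--Leininger game after a rescaling
of time and payoffs by `δ`. -/
lemma expect_btPayoff {δ : ℝ} (h0 : 0 < δ) (h1 : δ < 1) (θ : D.Θ) {σ : D.Θ → ℝ≥0∞}
    (hσ : Measurable σ) (a : ℝ≥0∞) :
    expect (D.btLaw (1 - δ)) (fun t => D.btPayoff (θ, false) (ENNReal.ofReal δ * a)
      (withCrazy (fun t => ENNReal.ofReal δ * σ t) t)) =
      if a = ∞ then ⊥ else ((δ * D.alValue δ θ σ a : ℝ) : EReal) := by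
  have hc : ENNReal.ofReal δ ≠ 0 := by simpa using h0
  have hc' : ENNReal.ofReal δ ≠ ∞ := ENNReal.ofReal_ne_top
  have hm : Measurable (withCrazy (fun t => ENNReal.ofReal δ * σ t)) :=
    (measurable_withCrazy_iff _).2 (hσ.const_mul _)
  have hbt : ∀ a b, D.btPayoff (θ, false) a b = basePayoff θ a b := fun a b => by simp [btPayoff]
  simp only [hbt]
  split_ifs with ha
  · subst ha
    rw [ENNReal.mul_top hc]
    refine expect_eq_bot (top_le_iff.1 ?_)
    -- Fighting forever against a crazy opponent costs `∞`, and this has probability `1 - δ > 0`.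
    have hle : ∀ t : D.Θ × Bool, (if t.2 = true then ∞ else 0) ≤
        (-basePayoff θ ∞ (withCrazy (fun t => ENNReal.ofReal δ * σ t) t)).toENNReal := by
      rintro ⟨t, b⟩
      cases b <;> simp [withCrazy, basePayoff_top_top]
    refine le_trans ?_ (lintegral_mono hle)
    rw [lintegral_btLaw (g := fun t : D.Θ × Bool => if t.2 = true then ∞ else 0) _
      (Measurable.ite (measurable_snd (measurableSet_singleton true)) measurable_const
        measurable_const)]
    simp [h1]
  · have ha' : ENNReal.ofReal δ * a ≠ ∞ := ENNReal.mul_ne_top hc' ha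
    simp only [basePayoff_eq_alPayoff_one, alPayoff_eq_coe zero_le_one le_rfl _ ha']
    rw [expect_coe (integrable_realPayoff 1 _ ha' hm), integral_btLaw (by linarith) (by linarith)
      (measurable_realPayoff 1 _ _ hm) (integrable_realPayoff 1 _ ha' hm)]
    congr 1
    simp only [withCrazy, Bool.false_eq_true, if_false, if_true]
    rw [integral_const, probReal_univ, one_smul, sub_sub_cancel, alValue, ← integral_const_mul,
      ← integral_const_mul]
    have hconst : (1 - δ) * realPayoff 1 θ (ENNReal.ofReal δ * a) ∞ =
        ∫ t, (1 - δ) * realPayoff 1 θ (ENNReal.ofReal δ * a) ∞ ∂D.μ := by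
      rw [integral_const, probReal_univ, one_smul]
    rw [hconst, ← integral_add ((integrable_realPayoff 1 _ ha' (hσ.const_mul _)).const_mul _)
      (integrable_const _)]
    congr 1
    funext t
    have hmin : min (ENNReal.ofReal δ * a) (ENNReal.ofReal δ * σ t) =
        ENNReal.ofReal δ * min a (σ t) := (mul_min_of_nonneg _ _ zero_le).symm
    have hw : winShare (ENNReal.ofReal δ * a) ∞ = 0 := by
      rw [winShare, if_neg not_top_lt, if_neg ha']
    simp only [realPayoff, hw, winShare_smul hc hc', hmin, min_top_right, ENNReal.toReal_mul,
      ENNReal.toReal_ofReal h0.le]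
    ring

/-- Makes the best-response condition of crazy types automatic. -/
lemma crazyPayoff_le_top {θ : ℝ} (hθ : 0 ≤ θ) (a b : ℝ≥0∞) :
    crazyPayoff θ a b ≤ crazyPayoff θ ∞ b := by
  have h0 : (0 : EReal) ≤ (θ : EReal) := EReal.coe_nonneg.2 hθ
  have h2 : ((θ / 2 : ℝ) : EReal) ≤ (θ : EReal) := EReal.coe_le_coe_iff.2 (by linarith)
  have h3 : (0 : EReal) ≤ ((θ / 2 : ℝ) : EReal) := EReal.coe_nonneg.2 (by linarith)
  unfold crazyPayoff
  by_cases hb : b = ∞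
  · subst hb
    simp only [not_top_lt, if_false, lt_self_iff_false, if_true]
    split_ifs <;> first | exact le_rfl | exact h3
  · rw [if_pos (lt_top_iff_ne_top.2 hb)]
    split_ifs <;> first | exact le_rfl | exact h2 | exact h0

lemma isBestResponse_bt_iff {δ : ℝ} (h0 : 0 < δ) (h1 : δ < 1) {σ σ' : D.Θ → ℝ≥0∞}
    (hσ' : Measurable σ') :
    IsBestResponse (D.btLaw (1 - δ)) D.btPayoff (withCrazy fun t => ENNReal.ofReal δ * σ t)
      (withCrazy fun t => ENNReal.ofReal δ * σ' t) ↔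
      IsBestResponse D.μ (fun θ : D.Θ => alPayoff δ θ) σ σ' := by
  have hc : ENNReal.ofReal δ ≠ 0 := by simpa using h0
  have hc' : ENNReal.ofReal δ ≠ ∞ := ENNReal.ofReal_ne_top
  rw [isBestResponse_al_iff h0.le h1 hσ']
  have hnormal : (∀ (θ : D.Θ) (a : ℝ≥0∞),
      expect (D.btLaw (1 - δ)) (fun t => D.btPayoff (θ, false) (ENNReal.ofReal δ * a)
        (withCrazy (fun t => ENNReal.ofReal δ * σ' t) t)) ≤
      expect (D.btLaw (1 - δ)) (fun t => D.btPayoff (θ, false) (ENNReal.ofReal δ * σ θ)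
        (withCrazy (fun t => ENNReal.ofReal δ * σ' t) t))) ↔
      ∀ θ, σ θ ≠ ∞ ∧ ∀ a, a ≠ ∞ → D.alValue δ θ σ' a ≤ D.alValue δ θ σ' (σ θ) := by
    refine forall_congr' fun θ => ?_
    simp only [expect_btPayoff h0 h1 θ hσ']
    rw [forall_ite_bot_le_iff fun a => δ * D.alValue δ θ σ' a]
    simp only [mul_le_mul_iff_right₀ h0]
  rw [← hnormal]
  constructor
  · intro h θ a
    exact h (θ, false) (ENNReal.ofReal δ * a)
  · rintro h ⟨θ, b⟩ a
    cases b
    -- Every deviation is a rescaled one, since multiplication by `δ` is invertible on `[0, ∞]`.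
    · have := h θ ((ENNReal.ofReal δ)⁻¹ * a)
      rwa [← mul_assoc, ENNReal.mul_inv_cancel hc hc', one_mul] at this
    · refine expect_mono fun t => ?_
      simp only [btPayoff, withCrazy, if_true]
      exact crazyPayoff_le_top (D.pos θ).le _ _

variable (D) in
/-- Rescaling of time. -/
def rescale (c : ℝ≥0∞) (p : D.Profile) : D.Profile := (fun t => c * p.1 t, fun t => c * p.2 t)

lemma rescale_rescale_inv {c : ℝ≥0∞} (hc : c ≠ 0) (hc' : c ≠ ∞) (p : D.Profile) :
    D.rescale c (D.rescale c⁻¹ p) = p := by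
  simp [rescale, ← mul_assoc, ENNReal.mul_inv_cancel hc hc']

lemma rescale_inv_rescale {c : ℝ≥0∞} (hc : c ≠ 0) (hc' : c ≠ ∞) (p : D.Profile) :
    D.rescale c⁻¹ (D.rescale c p) = p := by
  simp [rescale, ← mul_assoc, ENNReal.inv_mul_cancel hc hc']

lemma measurable_const_mul_iff {c : ℝ≥0∞} (hc : c ≠ 0) (hc' : c ≠ ∞) (σ : D.Θ → ℝ≥0∞) :
    Measurable (fun t => c * σ t) ↔ Measurable σ := by
  refine ⟨fun h => ?_, fun h => h.const_mul c⟩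
  have := h.const_mul c⁻¹
  simpa [← mul_assoc, ENNReal.inv_mul_cancel hc hc'] using this

lemma rescale_mem_btEquilibria_iff {δ : ℝ} (hδ : δ ∈ Ioo (0 : ℝ) 1) (p : D.Profile) :
    D.rescale (ENNReal.ofReal δ) p ∈ D.btEquilibria (1 - δ) ↔ p ∈ D.alEquilibria δ := by
  have hc : ENNReal.ofReal δ ≠ 0 := by simpa using hδ.1
  have hc' : ENNReal.ofReal δ ≠ ∞ := ENNReal.ofReal_ne_top
  simp only [btEquilibria, alEquilibria, rescale, IsBNE, mem_ofPred_eq, measurable_withCrazy_iff,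
    measurable_const_mul_iff hc hc', mul_ne_zero_iff, ne_eq, hc, not_false_eq_true, true_and]
  refine and_congr_left fun _ => and_congr_right fun m1 => and_congr_right fun m2 => ?_
  rw [isBestResponse_bt_iff hδ.1 hδ.2 m1, isBestResponse_bt_iff hδ.1 hδ.2 m2]

lemma bijOn_rescale {δ : ℝ} (hδ : δ ∈ Ioo (0 : ℝ) 1) :
    BijOn (D.rescale (ENNReal.ofReal δ)) (D.alEquilibria δ) (D.btEquilibria (1 - δ)) := by
  have hc : ENNReal.ofReal δ ≠ 0 := by simpa using hδ.1
  have hc' : ENNReal.ofReal δ ≠ ∞ := ENNReal.ofReal_ne_top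
  refine ⟨fun p hp => (rescale_mem_btEquilibria_iff hδ p).2 hp, fun p _ q _ h => ?_, fun p hp => ?_⟩
  · rw [← rescale_inv_rescale hc hc' p, h, rescale_inv_rescale hc hc' q]
  · refine ⟨D.rescale (ENNReal.ofReal δ)⁻¹ p, ?_, rescale_rescale_inv hc hc' p⟩
    rwa [← rescale_mem_btEquilibria_iff hδ, rescale_rescale_inv hc hc']

lemma isTypeToType_rescale_iff {c : ℝ≥0∞} (hc : c ≠ 0) (hc' : c ≠ ∞) (p : D.Profile)
    (k : D.Θ → ℝ) : D.IsTypeToType (D.rescale c p) k ↔ D.IsTypeToType p k := by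
  simp only [IsTypeToType, rescale, mul_eq_zero, hc, false_or, ne_eq, ENNReal.mul_eq_top,
    not_false_eq_true, true_and, hc', false_and, or_false, ENNReal.mul_right_inj hc hc']

/-! ### Symmetry of equilibria -/

lemma alValue_eq {δ θ : ℝ} {σ : D.Θ → ℝ≥0∞} (hσ : Measurable σ) (hfin : ∀ t, σ t ≠ ∞)
    {a : ℝ} (ha : 0 ≤ a) :
    D.alValue δ θ σ (ENNReal.ofReal a) =
      θ * winProb (fun t => (σ t).toReal) a - expCost δ (fun t => (σ t).toReal) a := by
  have hm := hσ.ennreal_toReal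
  have m1 : MeasurableSet {t : D.Θ | (σ t).toReal < a} := measurableSet_lt hm measurable_const
  have m2 : MeasurableSet {t : D.Θ | (σ t).toReal = a} := hm (measurableSet_singleton a)
  have i1 : Integrable ({t : D.Θ | (σ t).toReal < a}.indicator (1 : D.Θ → ℝ)) D.μ :=
    (integrable_const (1 : ℝ)).indicator m1
  have i2 : Integrable ({t : D.Θ | (σ t).toReal = a}.indicator (1 : D.Θ → ℝ)) D.μ :=
    (integrable_const (1 : ℝ)).indicator m2
  have hw : winProb (fun t => (σ t).toReal) a = ∫ t, ({t : D.Θ | (σ t).toReal < a}.indicator 1 t +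
      {t : D.Θ | (σ t).toReal = a}.indicator 1 t / 2) ∂D.μ := by
    rw [integral_add i1 (i2.div_const 2), integral_div, integral_indicator_one m1,
      integral_indicator_one m2, winProb]
  have i3 : Integrable (fun t => θ * ({t : D.Θ | (σ t).toReal < a}.indicator 1 t +
      {t : D.Θ | (σ t).toReal = a}.indicator 1 t / 2)) D.μ :=
    (i1.add (i2.div_const 2)).const_mul θ
  rw [hw, expCost, ← integral_const_mul, ← integral_sub i3
    (integrable_expCost δ hm (fun _ => ENNReal.toReal_nonneg) ha), alValue]
  congr 1
  funext t
  have e1 : σ t < ENNReal.ofReal a ↔ (σ t).toReal < a := by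
    rw [← ENNReal.ofReal_toReal (hfin t), ENNReal.ofReal_lt_ofReal_iff_of_nonneg
      ENNReal.toReal_nonneg, ENNReal.toReal_ofReal ENNReal.toReal_nonneg]
  have e2 : ENNReal.ofReal a = σ t ↔ (σ t).toReal = a := by
    rw [← ENNReal.toReal_eq_toReal_iff' ENNReal.ofReal_ne_top (hfin t), ENNReal.toReal_ofReal ha,
      eq_comm]
  have e3 : (min (ENNReal.ofReal a) (σ t)).toReal = min a (σ t).toReal := by
    rw [ENNReal.toReal_min ENNReal.ofReal_ne_top (hfin t), ENNReal.toReal_ofReal ha]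
  simp only [realPayoff, winShare, e1, e2, e3, ENNReal.toReal_ofReal ha, indicator, mem_ofPred_eq,
    Pi.one_apply]
  congr 2
  split_ifs with h1 h2 h2
  · exact absurd h2 h1.ne
  · ring
  · ring
  · ring

/-- A profile in which both players use the same injective strategy with values in `(0, ∞)`. -/
def IsSymmetric (p : D.Profile) : Prop :=
  p.1 = p.2 ∧ Function.Injective p.1 ∧ ∀ θ, p.1 θ ≠ 0 ∧ p.1 θ ≠ ∞

theorem isSymmetric_of_mem_alEquilibria {δ : ℝ} (hδ : δ ∈ Ioo (0 : ℝ) 1) {p : D.Profile}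
    (hp : p ∈ D.alEquilibria δ) : IsSymmetric p := by
  obtain ⟨⟨m1, m2, b1, b2⟩, hne⟩ := hp
  rw [isBestResponse_al_iff hδ.1.le hδ.2 m2] at b1
  rw [isBestResponse_al_iff hδ.1.le hδ.2 m1] at b2
  have hf1 : ∀ t, p.1 t ≠ ∞ := fun t => (b1 t).1
  have hf2 : ∀ t, p.2 t ≠ ∞ := fun t => (b2 t).1
  have E : IsRealEq δ (fun t => (p.1 t).toReal) fun t => (p.2 t).toReal := by
    refine ⟨hδ.1, hδ.2, m1.ennreal_toReal, m2.ennreal_toReal, fun _ => ENNReal.toReal_nonneg,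
      fun _ => ENNReal.toReal_nonneg, fun θ a ha => ?_, fun θ a ha => ?_⟩
    · have h := (b1 θ).2 (ENNReal.ofReal a) ENNReal.ofReal_ne_top
      rwa [← ENNReal.ofReal_toReal (hf1 θ), alValue_eq m2 hf2 ha,
        alValue_eq m2 hf2 ENNReal.toReal_nonneg] at h
    · have h := (b2 θ).2 (ENNReal.ofReal a) ENNReal.ofReal_ne_top
      rwa [← ENNReal.ofReal_toReal (hf2 θ), alValue_eq m1 hf1 ha,
        alValue_eq m1 hf1 ENNReal.toReal_nonneg] at h
  have hpos : ∀ t, 0 < (p.2 t).toReal := fun t => ENNReal.toReal_pos (hne t) (hf2 t)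
  have heq : p.1 = p.2 := by
    funext t
    exact (ENNReal.toReal_eq_toReal_iff' (hf1 t) (hf2 t)).1 (congrFun (E.eq hpos) t)
  refine ⟨heq, fun θ t h => ?_, fun θ => ⟨heq ▸ hne θ, hf1 θ⟩⟩
  rw [heq] at h
  exact E.inj (hpos θ) (congrArg ENNReal.toReal h)

theorem isSymmetric_of_mem_btEquilibria {δ : ℝ} (hδ : δ ∈ Ioo (0 : ℝ) 1) {p : D.Profile}
    (hp : p ∈ D.btEquilibria (1 - δ)) : IsSymmetric p := by
  have hc : ENNReal.ofReal δ ≠ 0 := by simpa using hδ.1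
  have hc' : ENNReal.ofReal δ ≠ ∞ := ENNReal.ofReal_ne_top
  obtain ⟨q, hq, rfl⟩ := (bijOn_rescale hδ).surjOn hp
  obtain ⟨h1, h2, h3⟩ := isSymmetric_of_mem_alEquilibria hδ hq
  refine ⟨by simp [rescale, h1], fun θ t h => h2 ((ENNReal.mul_right_inj hc hc').1 h), fun θ =>
    ⟨mul_ne_zero hc (h3 θ).1, ENNReal.mul_ne_top hc' (h3 θ).2⟩⟩

lemma IsSymmetric.isTypeToType_iff {p : D.Profile} (hp : IsSymmetric p) (k : D.Θ → ℝ) :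
    D.IsTypeToType p k ↔ k = Subtype.val := by
  obtain ⟨h1, h2, h3⟩ := hp
  constructor
  · intro h
    funext θ
    obtain ⟨t, ht, ht'⟩ := (h θ).2.1 (h3 θ).1 (h3 θ).2
    rw [← h1] at ht'
    rw [← ht, h2 ht']
  · rintro rfl θ
    exact ⟨fun h => absurd h (h3 θ).1, fun _ _ => ⟨θ, rfl, by rw [h1]⟩,
      fun h => absurd h (h3 θ).2⟩

end TypeLaw

namespace TypeLaw

variable (D : TypeLaw)

/-! ### The symmetric equilibrium of the original game -/

/-- The density, with respect to the law of types, of the symmetric equilibrium strategy. -/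
def stopRate (x : D.Θ) : ℝ≥0∞ := ENNReal.ofReal x / D.μ (Ici x)

/-- The measure whose distribution function is the symmetric equilibrium strategy. -/
def stopMeasure : Measure D.Θ := D.μ.withDensity D.stopRate

/-- The symmetric equilibrium strategy of the original game. -/
def symStrategy (θ : D.Θ) : ℝ≥0∞ := D.stopMeasure (Iic θ)

variable {D}

lemma μ_Ici_ne_zero (x : D.Θ) : D.μ (Ici x) ≠ 0 := by
  obtain ⟨t, ht, -⟩ := D.exists_gt_of_pos x one_pos
  exact ((D.μ_Ioo_pos ht).trans_le (measure_mono fun z hz => hz.1.le)).ne'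

lemma measurable_coe_ofReal : Measurable fun x : D.Θ => ENNReal.ofReal (x : ℝ) :=
  measurable_subtype_coe.ennreal_ofReal

lemma measurable_μ_Ici : Measurable fun x : D.Θ => D.μ (Ici x) :=
  (show Antitone fun x : D.Θ => D.μ (Ici x) from
    fun _ _ h => measure_mono (Ici_subset_Ici.2 h)).measurable

lemma measurable_stopRate : Measurable D.stopRate :=
  measurable_coe_ofReal.div measurable_μ_Ici

lemma stopRate_ne_zero (x : D.Θ) : D.stopRate x ≠ 0 :=
  ENNReal.div_ne_zero.2 ⟨by simpa using D.pos x, measure_ne_top _ _⟩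

lemma stopRate_mul (x : D.Θ) : D.stopRate x * D.μ (Ici x) = ENNReal.ofReal x :=
  ENNReal.div_mul_cancel (μ_Ici_ne_zero x) (measure_ne_top _ _)

instance sFinite_stopMeasure : SFinite D.stopMeasure := by
  unfold stopMeasure; infer_instance

lemma symStrategy_ne_top (θ : D.Θ) : D.symStrategy θ ≠ ∞ := by
  rw [symStrategy, stopMeasure, withDensity_apply _ measurableSet_Iic]
  have hle : ∫⁻ x in Iic θ, D.stopRate x ∂D.μ ≤ ∫⁻ x in Iic θ, D.stopRate θ ∂D.μ :=
    setLIntegral_mono measurable_const fun x hx => ENNReal.div_le_div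
      (ENNReal.ofReal_le_ofReal hx) (measure_mono (Ici_subset_Ici.2 hx))
  refine ne_top_of_le_ne_top ?_ hle
  rw [setLIntegral_const]
  exact ENNReal.mul_ne_top (ENNReal.div_ne_top ENNReal.ofReal_ne_top (μ_Ici_ne_zero θ))
    (measure_ne_top _ _)

lemma symStrategy_strictMono : StrictMono D.symStrategy := by
  intro x y h
  have hpos : D.stopMeasure (Ioo x y) ≠ 0 := by
    rw [stopMeasure, Ne, withDensity_apply_eq_zero measurable_stopRate]
    simpa [stopRate_ne_zero] using (D.μ_Ioo_pos h).ne'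
  calc D.symStrategy x < D.symStrategy x + D.stopMeasure (Ioo x y) :=
        ENNReal.lt_add_right (symStrategy_ne_top x) hpos
    _ = D.stopMeasure (Iic x ∪ Ioo x y) :=
        (measure_union (Set.disjoint_left.2 fun z hz hz' => absurd hz'.1 (not_lt.2 hz))
          measurableSet_Ioo).symm
    _ ≤ D.symStrategy y := measure_mono
        (union_subset (Iic_subset_Iic.2 h.le) fun z hz => hz.2.le)

lemma symStrategy_ne_zero (θ : D.Θ) : D.symStrategy θ ≠ 0 := by
  obtain ⟨t, ht, -⟩ := D.exists_lt_of_pos θ one_pos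
  exact (pos_of_gt (symStrategy_strictMono ht)).ne'

lemma measurable_symStrategy : Measurable D.symStrategy :=
  symStrategy_strictMono.monotone.measurable

/-- The set is a directed union of the initial segments `Iic x` over its own elements, each of
measure below `a`. -/
lemma stopMeasure_setOf_lt_le (a : ℝ≥0∞) : D.stopMeasure {x | D.symStrategy x < a} ≤ a := by
  set A : Set D.Θ := {x | D.symStrategy x < a} with hA
  have hlow : IsLowerSet A := fun x y h hx => (symStrategy_strictMono.monotone h).trans_lt hx
  have hconn : OrdConnected A := hlow.ordConnected
  rcases isEmpty_or_nonempty A with he | hne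
  · rw [isEmpty_coe_sort.1 he, measure_empty]
    exact zero_le
  · have hU : A = ⋃ x : A, Iic (x : D.Θ) := by
      refine Subset.antisymm (fun x hx => mem_iUnion.2 ⟨⟨x, hx⟩, mem_Iic.2 le_rfl⟩) ?_
      exact iUnion_subset fun x z hz => hlow hz x.2
    have hmono : Monotone fun x : A => Iic (x : D.Θ) := fun _ _ h => Iic_subset_Iic.2 h
    rw [hU, hmono.measure_iUnion]
    exact iSup_le fun x => x.2.le

/-- Expected cost of the stopping time `a` against the symmetric equilibrium strategy. -/
def symCost (D : TypeLaw) (a : ℝ≥0∞) : ℝ≥0∞ := ∫⁻ t, min a (D.symStrategy t) ∂D.μ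

/-- Tonelli: a type `x` is counted by all `t ≥ x`, and the factor `μ (Ici x)` cancels the
denominator of `stopRate`. -/
lemma lintegral_stopMeasure_inter {A : Set D.Θ} (hA : MeasurableSet A) :
    ∫⁻ t, D.stopMeasure (A ∩ Iic t) ∂D.μ = ∫⁻ x in A, ENNReal.ofReal x ∂D.μ := by
  have hS : MeasurableSet {q : D.Θ × D.Θ | q.2 ∈ A ∧ q.2 ≤ q.1} :=
    (measurable_snd hA).inter 
      (measurableSet_le (f := fun q : D.Θ × D.Θ => q.2) (g := fun q => q.1) measurable_snd
        measurable_fst)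
  have h1 := Measure.prod_apply (μ := D.μ) (ν := D.stopMeasure) hS
  have h2 := Measure.prod_apply_symm (μ := D.μ) (ν := D.stopMeasure) hS
  have e1 : ∀ t : D.Θ, Prod.mk t ⁻¹' {q : D.Θ × D.Θ | q.2 ∈ A ∧ q.2 ≤ q.1} = A ∩ Iic t :=
    fun t => rfl
  have e2 : ∀ x : D.Θ, D.μ ((fun t => (t, x)) ⁻¹' {q : D.Θ × D.Θ | q.2 ∈ A ∧ q.2 ≤ q.1}) =
      A.indicator (fun x => D.μ (Ici x)) x := by
    intro x
    by_cases hx : x ∈ A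
    · rw [indicator_of_mem hx]
      congr 1
      ext t
      simp [hx]
    · rw [indicator_of_notMem hx]
      simp [hx]
  simp only [e1] at h1
  simp only [e2] at h2
  rw [← h1, h2, lintegral_indicator hA, stopMeasure,
    setLIntegral_withDensity_eq_setLIntegral_mul _ measurable_stopRate measurable_μ_Ici hA]
  simp only [Pi.mul_apply, stopRate_mul]

lemma le_symCost (a : ℝ≥0∞) :
    ∫⁻ x in {x | D.symStrategy x < a}, ENNReal.ofReal x ∂D.μ ≤ D.symCost a := by
  rw [← lintegral_stopMeasure_inter (measurableSet_lt measurable_symStrategy measurable_const)]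
  exact lintegral_mono fun t => le_min
    ((measure_mono inter_subset_left).trans (stopMeasure_setOf_lt_le a))
    (measure_mono inter_subset_right)

lemma symCost_symStrategy (θ : D.Θ) :
    D.symCost (D.symStrategy θ) = ∫⁻ x in Iic θ, ENNReal.ofReal x ∂D.μ := by
  rw [← lintegral_stopMeasure_inter measurableSet_Iic, symCost]
  refine lintegral_congr fun t => ?_
  rw [Iic_inter_Iic, ← symStrategy_strictMono.monotone.map_min]
  rfl

lemma symCost_ne_top {a : ℝ≥0∞} (ha : a ≠ ∞) : D.symCost a ≠ ∞ := by
  refine ne_top_of_le_ne_top ha ?_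
  calc D.symCost a ≤ ∫⁻ _, a ∂D.μ := lintegral_mono fun t => min_le_left _ _
    _ = a := by simp

/-- Expected payoff of a finite stopping time against the symmetric equilibrium strategy. -/
def symValue (D : TypeLaw) (θ : ℝ) (a : ℝ≥0∞) : ℝ :=
  θ * D.μ.real {t | D.symStrategy t < a} - (D.symCost a).toReal

/-- Beating the set `A` of types is worth at most `∫ (θ - x)` over `A`, which is largest for `A = {x
≤ θ}`; there the cost bound is an equality. -/
lemma symValue_le (θ : D.Θ) {a : ℝ≥0∞} (ha : a ≠ ∞) :
    D.symValue θ a ≤ D.symValue θ (D.symStrategy θ) := by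
  set A : Set D.Θ := {t | D.symStrategy t < a} with hA
  have hAm : MeasurableSet A := measurableSet_lt measurable_symStrategy measurable_const
  have hset : {t | D.symStrategy t < D.symStrategy θ} = Iio θ := by
    ext t; exact symStrategy_strictMono.lt_iff_lt
  -- Written with sums to avoid truncated subtraction in `ℝ≥0∞`.
  have key : ENNReal.ofReal θ * D.μ A + D.symCost (D.symStrategy θ) ≤
      ENNReal.ofReal θ * D.μ (Iic θ) + D.symCost a := by
    refine le_trans ?_ (add_le_add_right (le_symCost a) _)
    rw [symCost_symStrategy, ← setLIntegral_const A, ← setLIntegral_const (Iic θ),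
      ← lintegral_indicator hAm, ← lintegral_indicator measurableSet_Iic,
      ← lintegral_indicator measurableSet_Iic, ← hA, ← lintegral_indicator hAm,
      ← lintegral_add_left (measurable_const.indicator hAm),
      ← lintegral_add_left (measurable_const.indicator measurableSet_Iic)]
    refine lintegral_mono fun x => ?_
    by_cases h1 : x ∈ A <;> by_cases h2 : x ≤ θ
    · simp [indicator, h1, h2]
    · simpa [indicator, h1, h2] using ENNReal.ofReal_le_ofReal (le_of_lt (not_le.1 h2))
    · simpa [indicator, h1, h2] using ENNReal.ofReal_le_ofReal h2
    · simp [indicator, h1, h2]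
  have hθ : symCost D (D.symStrategy θ) ≠ ∞ := symCost_ne_top (symStrategy_ne_top θ)
  have hm : ∀ B : Set D.Θ, ENNReal.ofReal θ * D.μ B ≠ ∞ := fun B =>
    ENNReal.mul_ne_top ENNReal.ofReal_ne_top (measure_ne_top _ _)
  have key' := ENNReal.toReal_mono (ENNReal.add_ne_top.2 ⟨hm _, symCost_ne_top ha⟩) key
  rw [ENNReal.toReal_add (hm _) hθ, ENNReal.toReal_add (hm _) (symCost_ne_top ha),
    ENNReal.toReal_mul, ENNReal.toReal_mul, ENNReal.toReal_ofReal (D.pos θ).le] at key'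
  have hIio : (D.μ (Iio θ)).toReal = (D.μ (Iic θ)).toReal := (D.cdfΘ_eq_Iio θ).symm
  simp only [symValue, ← hA, hset, Measure.real, hIio]
  linarith

lemma toReal_symCost {a : ℝ≥0∞} (ha : a ≠ ∞) :
    (D.symCost a).toReal = ∫ t, (min a (D.symStrategy t)).toReal ∂D.μ :=
  (integral_toReal (measurable_const.min measurable_symStrategy).aemeasurable
    (Eventually.of_forall fun _ => (min_le_left _ _).trans_lt (lt_top_iff_ne_top.2 ha))).symm

lemma integrable_min_symStrategy {a : ℝ≥0∞} (ha : a ≠ ∞) :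
    Integrable (fun t => (min a (D.symStrategy t)).toReal) D.μ :=
  integrable_toReal_of_lintegral_ne_top
    (measurable_const.min measurable_symStrategy).aemeasurable (symCost_ne_top ha)

lemma expect_basePayoff (θ : ℝ) {a : ℝ≥0∞} (ha : a ≠ ∞) :
    expect D.μ (fun t => basePayoff θ a (D.symStrategy t)) = (D.symValue θ a : EReal) := by
  have hAm : MeasurableSet {t | D.symStrategy t < a} :=
    measurableSet_lt measurable_symStrategy measurable_const
  simp only [basePayoff_eq_alPayoff_one, alPayoff_eq_coe zero_le_one le_rfl θ ha]
  rw [expect_coe (integrable_realPayoff 1 θ ha measurable_symStrategy)]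
  congr 1
  have hi : Integrable ({t | D.symStrategy t < a}.indicator (1 : D.Θ → ℝ)) D.μ :=
    (integrable_const (1 : ℝ)).indicator hAm
  rw [symValue, toReal_symCost ha, ← integral_indicator_one hAm, ← integral_const_mul,
    ← integral_sub (hi.const_mul θ) (integrable_min_symStrategy ha)]
  refine integral_congr_ae ?_
  have hnull : D.μ {t | D.symStrategy t = a} = 0 :=
    (Set.Subsingleton.measure_zero (fun x hx y hy =>
      symStrategy_strictMono.injective (Eq.trans hx (Eq.symm hy))) D.μ)
  filter_upwards [measure_eq_zero_iff_ae_notMem.1 hnull] with t ht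
  have ht' : a ≠ D.symStrategy t := fun h => ht h.symm
  simp only [realPayoff, winShare, ht', if_false, indicator, mem_ofPred_eq, Pi.one_apply]
  ring

/-- Charging only the cost up to the stopping time of `y` bounds the payoff by that of stopping
there plus `θ (1 - F(y))`, and the latter term vanishes as `y` rises. -/
lemma expect_basePayoff_top_le (θ : D.Θ) :
    expect D.μ (fun t => basePayoff θ ∞ (D.symStrategy t)) ≤
      (D.symValue θ (D.symStrategy θ) : EReal) := by
  have hle : ∀ y : D.Θ, expect D.μ (fun t => basePayoff θ ∞ (D.symStrategy t)) ≤
      ((D.symValue θ (D.symStrategy θ) + θ * (1 - D.cdfΘ y) : ℝ) : EReal) := by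
    intro y
    have hy := symStrategy_ne_top y
    have hi : Integrable
        (fun t => (θ : ℝ) - (min (D.symStrategy y) (D.symStrategy t)).toReal) D.μ :=
      (integrable_const _).sub (integrable_min_symStrategy hy)
    have hpt : ∀ t, basePayoff θ ∞ (D.symStrategy t) ≤
        (((θ : ℝ) - (min (D.symStrategy y) (D.symStrategy t)).toReal : ℝ) : EReal) := by
      intro t
      have ht := symStrategy_ne_top t
      rw [basePayoff, if_pos (lt_top_iff_ne_top.2 ht), ← EReal.coe_ennreal_toReal ht,
        ← EReal.coe_sub, EReal.coe_le_coe_iff]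
      have := ENNReal.toReal_mono ht (min_le_right (D.symStrategy y) (D.symStrategy t))
      linarith
    refine (expect_mono hpt).trans ?_
    rw [expect_coe hi, EReal.coe_le_coe_iff, integral_sub (integrable_const _)
      (integrable_min_symStrategy hy), ← toReal_symCost hy, integral_const, probReal_univ,
      one_smul]
    have h1 := symValue_le θ hy
    have hset : {t | D.symStrategy t < D.symStrategy y} = Iio y := by
      ext t; exact symStrategy_strictMono.lt_iff_lt
    have h2 : D.symValue θ (D.symStrategy y) =
        θ * D.cdfΘ y - (D.symCost (D.symStrategy y)).toReal := by
      rw [symValue, hset, ← D.cdfΘ_eq_Iio]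
    rw [h2] at h1
    linarith
  have hlim : Tendsto (fun y : D.Θ =>
      ((D.symValue θ (D.symStrategy θ) + θ * (1 - D.cdfΘ y) : ℝ) : EReal)) atTop
      (𝓝 (D.symValue θ (D.symStrategy θ) : EReal)) := by
    refine (continuous_coe_real_ereal.tendsto _).comp ?_
    have := ((D.tendsto_cdfΘ_atTop.const_sub 1).const_mul (θ : ℝ)).const_add
      (D.symValue θ (D.symStrategy θ))
    simpa using this
  exact ge_of_tendsto hlim (Eventually.of_forall hle)

lemma isBestResponse_symStrategy :
    IsBestResponse D.μ (fun θ : D.Θ => basePayoff θ) D.symStrategy D.symStrategy := by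
  intro θ a
  change _ ≤ expect D.μ fun t => basePayoff θ (D.symStrategy θ) (D.symStrategy t)
  rw [expect_basePayoff θ (symStrategy_ne_top θ)]
  by_cases ha : a = ∞
  · subst ha
    exact expect_basePayoff_top_le θ
  · change expect D.μ (fun t => basePayoff θ a (D.symStrategy t)) ≤ _
    rw [expect_basePayoff θ ha]
    exact EReal.coe_le_coe_iff.2 (symValue_le θ ha)

variable (D) in
/-- The inclusion of the type space, as a type-to-type function. -/
def inclusionMap : D.MapSpace := UniformOnFun.ofFun _ (Subtype.val : D.Θ → ℝ)

lemma inclusionMap_mem_baseE : D.inclusionMap ∈ D.baseE := by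
  refine ⟨(D.symStrategy, D.symStrategy), ⟨⟨measurable_symStrategy, measurable_symStrategy,
    isBestResponse_symStrategy, isBestResponse_symStrategy⟩, symStrategy_ne_zero⟩, ?_⟩
  exact (IsSymmetric.isTypeToType_iff ⟨rfl, symStrategy_strictMono.injective,
    fun θ => ⟨symStrategy_ne_zero θ, symStrategy_ne_top θ⟩⟩ _).2 rfl

/-! ### The perturbed hazard potential -/

lemma F_monotone : Monotone D.F := fun _ _ h =>
  ENNReal.toReal_mono (measure_ne_top _ _) (measure_mono fun _ ht => le_trans ht h)

lemma F_le_one (x : ℝ) : D.F x ≤ 1 := measureReal_le_one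

lemma one_sub_mul_F_ge {δ : ℝ} (hδ : δ ∈ Ioo (0 : ℝ) 1) (x : ℝ) : 1 - δ ≤ 1 - δ * D.F x := by
  have := mul_le_mul_of_nonneg_left (F_le_one (D := D) x) hδ.1.le
  linarith

/-- Only monotonicity of `F` is used: `f(z) / z` is continuous on the interval and the other factor
is at most `1 / (1 - δ)`. -/
lemma intervalIntegrable_hazard {δ : ℝ} (hδ : δ ∈ Ioo (0 : ℝ) 1) {x y : ℝ} (hx : x ∈ D.Θ)
    (hy : y ∈ D.Θ) :
    IntervalIntegrable (fun z => D.f z / (z * (1 - δ * D.F z))) volume x y := by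
  have hsub : uIcc x y ⊆ D.Θ := D.ordConnected_Θ.uIcc_subset hx hy
  have hpos : ∀ z ∈ D.Θ, 0 < z := fun z hz => D.pos ⟨z, hz⟩
  have h1 : IntervalIntegrable (fun z => D.f z / z) volume x y :=
    ((D.f_cont.mono hsub).div continuousOn_id fun z hz =>
      (hpos z (hsub hz)).ne').intervalIntegrable
  have hmeas : Measurable fun z => (1 - δ * D.F z)⁻¹ :=
    (measurable_const.sub (F_monotone.measurable.const_mul δ)).inv
  have heq : (fun z => D.f z / (z * (1 - δ * D.F z))) =
      fun z => D.f z / z * (1 - δ * D.F z)⁻¹ := by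
    funext z
    rw [div_mul_eq_div_div, div_eq_mul_inv (D.f z / z)]
  rw [heq]
  refine (h1.mul_const (1 - δ)⁻¹).mono_fun ?_ (Eventually.of_forall fun z => ?_)
  · exact (intervalIntegrable_iff.1 h1).aestronglyMeasurable.mul hmeas.aestronglyMeasurable
  · have hδ' : 0 < 1 - δ := sub_pos.2 hδ.2
    have hge := one_sub_mul_F_ge (D := D) hδ z
    simp only [norm_mul]
    refine mul_le_mul_of_nonneg_left ?_ (norm_nonneg _)
    rw [Real.norm_of_nonneg (inv_nonneg.2 (hδ'.le.trans hge)),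
      Real.norm_of_nonneg (inv_nonneg.2 hδ'.le)]
    exact inv_anti₀ hδ' hge

lemma strictMonoOn_hazardPotential {δ : ℝ} (hδ : δ ∈ Ioo (0 : ℝ) 1) (θ₀ : D.Θ) :
    StrictMonoOn (D.hazardPotential δ θ₀) D.Θ := by
  intro x hx y hy hxy
  rw [← sub_pos, hazardPotential, hazardPotential, intervalIntegral.integral_interval_sub_left
    (intervalIntegrable_hazard hδ θ₀.2 hy) (intervalIntegrable_hazard hδ θ₀.2 hx)]
  refine intervalIntegral.intervalIntegral_pos_of_pos_on (intervalIntegrable_hazard hδ hx hy)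
    (fun z hz => ?_) hxy
  have hz' : z ∈ D.Θ := D.ordConnected_Θ.out hx hy (Ioo_subset_Icc_self hz)
  exact div_pos (D.f_pos z hz'.1 hz'.2) (mul_pos (D.pos ⟨z, hz'⟩)
    ((sub_pos.2 hδ.2).trans_le (one_sub_mul_F_ge hδ z)))

lemma solvesODE_coe {δ : ℝ} (hδ : δ ∈ Ioo (0 : ℝ) 1) (p : D.Profile) :
    D.SolvesODE δ p Subtype.val := by
  intro θ _ _
  have h1 : D.odeRHS δ θ θ = 1 := by
    have e1 := ((sub_pos.2 hδ.2).trans_le (one_sub_mul_F_ge (D := D) hδ θ)).ne'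
    have e2 := (D.pos θ).ne'
    have e3 := (D.f_pos θ θ.2.1 θ.2.2).ne'
    rw [odeRHS, div_self e1, div_self (mul_ne_zero e2 e3), one_mul]
  rw [h1]
  refine (hasDerivAt_id (θ : ℝ)).congr_of_eventuallyEq ?_
  filter_upwards [D.isOpen_Θ.mem_nhds θ.2] with x hx
  exact Subtype.val_injective.extend_apply Subtype.val (fun _ => 0) (⟨x, hx⟩ : D.Θ)

lemma hasPotential_coe (δ : ℝ) (p : D.Profile) : D.HasPotential δ p Subtype.val :=
  fun _ => ⟨0, fun _ _ _ => sub_self _⟩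

lemma IsSymmetric.typeToType_properties {δ : ℝ} (hδ : δ ∈ Ioo (0 : ℝ) 1) {p : D.Profile}
    (hp : IsSymmetric p) :
    ∃ k : D.Θ → ℝ, D.IsTypeToType p k ∧ (∀ k', D.IsTypeToType p k' → k' = k) ∧
      D.SolvesODE δ p k ∧ D.HasPotential δ p k :=
  ⟨Subtype.val, (hp.isTypeToType_iff _).2 rfl, fun k' hk' => (hp.isTypeToType_iff k').1 hk',
    solvesODE_coe hδ p, hasPotential_coe δ p⟩

/-! ### Outer limits -/

lemma alE_eq_btE {δ : ℝ} (hδ : δ ∈ Ioo (0 : ℝ) 1) : D.alE δ = D.btE (1 - δ) := by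
  have hc : ENNReal.ofReal δ ≠ 0 := by simpa using hδ.1
  have hc' : ENNReal.ofReal δ ≠ ∞ := ENNReal.ofReal_ne_top
  ext k
  constructor
  · rintro ⟨p, hp, hk⟩
    exact ⟨_, (bijOn_rescale hδ).mapsTo hp, (isTypeToType_rescale_iff hc hc' p _).2 hk⟩
  · rintro ⟨p, hp, hk⟩
    obtain ⟨q, hq, rfl⟩ := (bijOn_rescale hδ).surjOn hp
    exact ⟨q, hq, (isTypeToType_rescale_iff hc hc' q _).1 hk⟩

/-- Reparametrization; applied with `x ↦ 1 - x` in both directions. -/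
lemma outerLimit_subset {ι ι' X : Type*} [TopologicalSpace X] {l : Filter ι} {l' : Filter ι'}
    {E : ι → Set X} {E' : ι' → Set X} (g : ι → ι') (hg : Tendsto g l l')
    (h : ∀ᶠ i in l, E i = E' (g i)) : outerLimit l E ⊆ outerLimit l' E' := by
  intro x hx
  refine mem_iInter₂.2 fun s hs => ?_
  refine closure_mono ?_ (mem_iInter₂.1 hx _ (inter_mem (hg hs) h))
  refine iUnion₂_subset fun i hi => ?_
  rw [show E i = E' (g i) from hi.2]
  exact subset_iUnion₂ (s := fun j (_ : j ∈ s) => E' j) (g i) hi.1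

lemma AL_eq_BT : D.AL = D.BT := by
  refine Subset.antisymm (outerLimit_subset (fun δ => 1 - δ) ?_ ?_)
    (outerLimit_subset (fun ε => 1 - ε) ?_ ?_)
  · refine tendsto_nhdsWithin_iff.2 ⟨?_, ?_⟩
    · have : Tendsto (fun δ : ℝ => 1 - δ) (𝓝 1) (𝓝 (1 - 1)) :=
        (continuous_const.sub continuous_id).tendsto _
      rw [sub_self] at this
      exact this.mono_left nhdsWithin_le_nhds
    · filter_upwards [self_mem_nhdsWithin] with δ hδ
      exact sub_pos.2 (mem_Iio.1 hδ)
  · filter_upwards [Ioo_mem_nhdsLT (zero_lt_one' ℝ)] with δ hδ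
    exact alE_eq_btE hδ
  · refine tendsto_nhdsWithin_iff.2 ⟨?_, ?_⟩
    · have : Tendsto (fun δ : ℝ => 1 - δ) (𝓝 0) (𝓝 (1 - 0)) :=
        (continuous_const.sub continuous_id).tendsto _
      rw [sub_zero] at this
      exact this.mono_left nhdsWithin_le_nhds
    · filter_upwards [self_mem_nhdsWithin] with ε hε
      exact sub_lt_self (1 : ℝ) (mem_Ioi.1 hε)
  · filter_upwards [Ioo_mem_nhdsGT (zero_lt_one' ℝ)] with ε hε
    rw [alE_eq_btE ⟨sub_pos.2 hε.2, sub_lt_self 1 hε.1⟩, sub_sub_cancel]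

lemma alE_subset {δ : ℝ} (hδ : δ ∈ Ioo (0 : ℝ) 1) : D.alE δ ⊆ {D.inclusionMap} := by
  rintro k ⟨p, hp, hk⟩
  have := ((isSymmetric_of_mem_alEquilibria hδ hp).isTypeToType_iff _).1 hk
  exact (UniformOnFun.toFun _).injective this

lemma outerLimit_subset_of_isClosed {ι X : Type*} [TopologicalSpace X] {l : Filter ι}
    {E : ι → Set X} {s : Set ι} {C : Set X} (hC : IsClosed C) (hs : s ∈ l)
    (h : ∀ i ∈ s, E i ⊆ C) : outerLimit l E ⊆ C := fun _ hx =>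
  closure_minimal (iUnion₂_subset h) hC (mem_iInter₂.1 hx s hs)

instance t2Space_mapSpace : T2Space D.MapSpace :=
  UniformOnFun.t2Space_of_covering
    (sUnion_eq_univ_iff.2 fun θ => ⟨{θ}, isCompact_singleton, mem_singleton θ⟩)

/-- Points are closed in this Hausdorff space, so the outer limit contains at most the inclusion. -/
lemma AL_subset_baseE : D.AL ⊆ D.baseE :=
  (outerLimit_subset_of_isClosed isClosed_singleton (Ioo_mem_nhdsLT (zero_lt_one' ℝ))
    fun _ hδ => alE_subset hδ).trans (singleton_subset_iff.2 inclusionMap_mem_baseE)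

end TypeLaw

end WarOfAttrition

end

theorem proposition1 (D : WarOfAttrition.TypeLaw) :
    -- (i) same differential equation and same hazard potential, `δ = 1 - ε`
    (∀ ε ∈ Ioo (0 : ℝ) 1, ∀ p ∈ D.btEquilibria ε,
      ∃ k : D.Θ → ℝ, D.IsTypeToType p k ∧ (∀ k', D.IsTypeToType p k' → k' = k) ∧
        D.SolvesODE (1 - ε) p k ∧ D.HasPotential (1 - ε) p k) ∧
    (∀ δ ∈ Ioo (0 : ℝ) 1, ∀ p ∈ D.alEquilibria δ,
      ∃ k : D.Θ → ℝ, D.IsTypeToType p k ∧ (∀ k', D.IsTypeToType p k' → k' = k) ∧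
        D.SolvesODE δ p k ∧ D.HasPotential δ p k) ∧
    (∀ δ ∈ Ioo (0 : ℝ) 1, ∀ θ₀ : D.Θ, StrictMonoOn (D.hazardPotential δ θ₀) D.Θ) ∧
    -- (ii) same equilibrium type-to-type functions, and a bijection of equilibria preserving them
    (∀ δ ∈ Ioo (0 : ℝ) 1, D.alE δ = D.btE (1 - δ) ∧
      ∃ φ : D.Profile → D.Profile, BijOn φ (D.alEquilibria δ) (D.btEquilibria (1 - δ)) ∧
        ∀ p ∈ D.alEquilibria δ, ∀ k : D.Θ → ℝ,
          D.IsTypeToType p k ↔ D.IsTypeToType (φ p) k) ∧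
    -- (iii) the selections coincide, as subsets of the equilibrium set of the original game
    (D.AL = D.BT ∧ D.AL ⊆ D.baseE) := by
  refine ⟨fun ε hε p hp => ?_, fun δ hδ p hp => ?_, fun δ hδ θ₀ => ?_, fun δ hδ => ⟨?_, ?_⟩, ?_, ?_⟩
  · have hδ : 1 - ε ∈ Ioo (0 : ℝ) 1 := ⟨sub_pos.2 hε.2, sub_lt_self 1 hε.1⟩
    rw [← sub_sub_cancel 1 ε] at hp
    exact (WarOfAttrition.TypeLaw.isSymmetric_of_mem_btEquilibria hδ hp).typeToType_properties hδ
  · exact (WarOfAttrition.TypeLaw.isSymmetric_of_mem_alEquilibria hδ hp).typeToType_properties hδ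
  · exact WarOfAttrition.TypeLaw.strictMonoOn_hazardPotential hδ θ₀
  · exact WarOfAttrition.TypeLaw.alE_eq_btE hδ
  · exact ⟨_, WarOfAttrition.TypeLaw.bijOn_rescale hδ, fun p _ k =>
      (WarOfAttrition.TypeLaw.isTypeToType_rescale_iff
        (by simpa using hδ.1) ENNReal.ofReal_ne_top p k).symm⟩
  · exact WarOfAttrition.TypeLaw.AL_eq_BT
  · exact WarOfAttrition.TypeLaw.AL_subset_baseE
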